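/- Let $I=[0,1)$. An $n$-PC is a map $f:I\to I$ for which there are $0<\lambda<1$ and a partition of $I$ into non-degenerate intervals $I_1,\dots,I_n$ such that each $f|_{I_i}$ is $\lambda$-Lipschitz; it is piecewise $\lambda$-affine if $f(x)=\sigma_i\lambda x+b_i$ on $I_i$ with $\sigma_i\in\{-1,1\}$, $b_i\in\mathbb R$. For a map $f:I\to I$ with such an associated partition, the natural coding $\theta_f(x)=\theta_0\theta_1\ldots$ of $x\in I$ is given by $\theta_k=i$ when $f^k(x)\in I_i$; a natural coding of $f$ is a word $\theta_f(x)$ with $x\in I$. The complexity function $p_\theta(k)$ is the number of distinct words of length $k$ occurring in $\theta$. A standard $n$-IET is a bijection $T:I\to I$ that is a translation on each interval $[x_{i-1},x_i)$, $1\le i\le n$, of a partition with endpoints $0=x_0<x_1<\dots<x_n=1$. It satisfies the i.d.o.c. if the forward orbits of $x_1,\dots,x_{n-1}$ are infinite and pairwise disjoint. (i) Let $\theta$ be a natural coding of an injective $n$-PC. Then there exist $\alpha\in\{0,1,\dots,n-1\}$, $\beta\ge1$ and $k_0\ge1$ such that $p_\theta(k)=\alpha k+\beta$ for every $k\ge k_0$,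 with $\beta=1$ if $\alpha=n-1$. (ii) Let $n\ge2$ and let $T$ be a standard $n$-IET satisfying the i.d.o.c. Then there exists an injective piecewise $\frac12$-affine contraction $f_T:I\to I$ of $n$ intervals for which there is a continuous, surjective, nondecreasing map $h:I\to I$ with $\theta_{f_T}(x)=\theta_T(h(x))$ for every $x\in I$; and for every such $f_T$, every natural coding $\theta$ of $f_T$ satisfies $p_\theta(k)=(n-1)k+1$ for every $k\ge1$. -/

import Mathlib

namespace IntervalDynamics

/-- The half-open unit interval `[0,1)`. -/
abbrev UnitIco : Type := Set.Ico (0 : ℝ) 1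

/-- `J 0, …, J (n-1)` is a partition of `[0,1)` into `n` non-degenerate intervals. -/
structure IsIntervalPartition {n : ℕ} (J : Fin n → Set UnitIco) : Prop where
  ordConnected : ∀ i, (J i).OrdConnected
  nontrivial : ∀ i, (J i).Nontrivial
  disjoint : ∀ i j, i ≠ j → Disjoint (J i) (J j)
  cover : ⋃ i, J i = Set.univ

/-- `f` is a piecewise contraction of `n` intervals (an `n`-PC) with associated partition `J`. -/
structure IsPC {n : ℕ} (J : Fin n → Set UnitIco) (f : UnitIco → UnitIco) : Prop where
  partition : IsIntervalPartition J
  contracts : ∃ lam : ℝ, 0 < lam ∧ lam < 1 ∧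
    ∀ i, ∀ x ∈ J i, ∀ y ∈ J i, |(f x : ℝ) - (f y : ℝ)| ≤ lam * |(x : ℝ) - (y : ℝ)|

/-- `f` is a piecewise `lam`-affine contraction of `n` intervals with associated partition `J`. -/
structure IsPiecewiseAffineContraction {n : ℕ} (lam : ℝ) (J : Fin n → Set UnitIco)
    (f : UnitIco → UnitIco) : Prop where
  partition : IsIntervalPartition J
  pos : 0 < lam
  lt_one : lam < 1
  affine : ∃ (s b : Fin n → ℝ), (∀ i, s i = 1 ∨ s i = -1) ∧
    ∀ i, ∀ x ∈ J i, (f x : ℝ) = s i * lam * (x : ℝ) + b i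

/-- `T` is a standard `n`-interval exchange transformation with associated partition `J`:
a bijection of `[0,1)` which is a translation on each of the left-closed, right-open
intervals `J i`. -/
structure IsStandardIET {n : ℕ} (J : Fin n → Set UnitIco) (T : UnitIco → UnitIco) : Prop where
  partition : IsIntervalPartition J
  bijective : Function.Bijective T
  halfOpen : ∀ i, ∃ a c : ℝ, 0 ≤ a ∧ a < c ∧ c ≤ 1 ∧ J i = {x | a ≤ (x : ℝ) ∧ (x : ℝ) < c}
  translation : ∃ b : Fin n → ℝ, ∀ i, ∀ x ∈ J i, (T x : ℝ) = (x : ℝ) + b i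

/-- The interior division points of a partition into left-closed intervals: the left endpoints of
its members, except `0`. For a partition into `n` left-closed, right-open intervals with endpoints
`0 = x₀ < x₁ < ⋯ < xₙ = 1` these are `x₁, …, xₙ₋₁`. -/
def divisionPoints {n : ℕ} (J : Fin n → Set UnitIco) : Set UnitIco :=
  {x | 0 < (x : ℝ) ∧ ∃ i, IsLeast (J i) x}

/-- The forward orbit `{x, T x, T² x, …}`. -/
def orbit (T : UnitIco → UnitIco) (x : UnitIco) : Set UnitIco :=
  Set.range fun k : ℕ => T^[k] x

/-- The infinite distinct orbit condition: the forward orbits of `x₁, …, xₙ₋₁` are infinite and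
pairwise disjoint. -/
structure IDOC {n : ℕ} (J : Fin n → Set UnitIco) (T : UnitIco → UnitIco) : Prop where
  infinite : ∀ x ∈ divisionPoints J, (orbit T x).Infinite
  disjoint : ∀ x ∈ divisionPoints J, ∀ y ∈ divisionPoints J, x ≠ y →
    Disjoint (orbit T x) (orbit T y)

/-- `θ` is the natural coding of the point `x` under `f`, with respect to the partition `J`. -/
def IsCodingOf {n : ℕ} (J : Fin n → Set UnitIco) (f : UnitIco → UnitIco) (x : UnitIco)
    (θ : ℕ → Fin n) : Prop :=
  ∀ k, f^[k] x ∈ J (θ k)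

/-- `θ` is a natural coding of `f`, with respect to the partition `J`. -/
def IsNaturalCoding {n : ℕ} (J : Fin n → Set UnitIco) (f : UnitIco → UnitIco)
    (θ : ℕ → Fin n) : Prop :=
  ∃ x, IsCodingOf J f x θ

/-- The set of words of length `k` that occur in the infinite word `θ`. -/
def factors {A : Type*} (θ : ℕ → A) (k : ℕ) : Set (Fin k → A) :=
  Set.range fun m : ℕ => fun j : Fin k => θ (m + j)

/-- The complexity function of an infinite word (over a finite alphabet). -/
noncomputable def complexity {A : Type*} [Finite A] (θ : ℕ → A) (k : ℕ) : ℕ :=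
  (factors θ k).ncard

/-- `f`, with partition `K`, is a contraction `f_T` associated with the interval exchange `T`, with
partition `J`: an injective piecewise `1/2`-affine contraction of `n` intervals for which there is
a continuous, surjective, nondecreasing map `h` of `[0,1)` such that, for every `x`, the natural
`f`-coding of `x` is the natural `T`-coding of `h x`. -/
structure IsAssociatedContraction {n : ℕ} (J : Fin n → Set UnitIco) (T : UnitIco → UnitIco)
    (K : Fin n → Set UnitIco) (f : UnitIco → UnitIco) : Prop where
  injective : Function.Injective f
  affine : IsPiecewiseAffineContraction (1 / 2) K f
  factor : ∃ h : UnitIco → UnitIco, Continuous h ∧ Function.Surjective h ∧ Monotone h ∧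
    ∀ x θ, IsCodingOf K f x θ ↔ IsCodingOf J T (h x) θ

end IntervalDynamics

open IntervalDynamics

/-!
The complexity grows by `p(k+1) - p(k) = #D(k)`, where `D(k)` (`branching`) is the set of letters
`i` that follow some word of length `k` which is also followed by a letter whose interval lies
above that of `i`. Indeed a map that is injective and continuous on each interval sends the cylinders
of length `k` by its `k`-th iterate to disjoint intervals (`cylinderImage`), and only one of them
can meet both the interval of `i` and the part of `[0,1)` above it, so that `i` branches after one
word only (`IsCodingOf.complexity_succ`). Since `D(k)` decreases with `k` and never contains the
top letter, its cardinality is eventually a constant `α ≤ n - 1`. It is at least `α` from the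
beginning, whence `p(k) ≥ α k + 1`; and if `α = n - 1` it is constant, whence `p(k) = α k + 1`.

For an interval exchange `T` satisfying the i.d.o.c., every forward orbit is dense
(`IDOC.exists_iterate_mem`). The set `W` of points not accumulated by a given orbit is open, and
invariant away from the left endpoints of the pieces. The left end of a component of `W` would
have an infinite orbit (there are no periodic points) of ends of components that are not shorter
than some `ε > 0`, which is absurd, unless it meets a left endpoint; applied to `T` and to its
inverse this gives a connection between division points
(`IDOC.false_of_gap`). Hence `W` is an interval starting at `0`, and its right end is treated in the
same way. By density, all letters but the top one branch at every length, and codings of `T` have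
complexity `(n - 1) k + 1` (`IDOC.complexity_eq`). The codings of an associated contraction are
codings of `T`.

To construct a contraction, a gap of length `2^-k` is opened at `T^k d`, for each `k ≥ 1`, where `d`
is a division point. A single `d` suffices, as its orbit is dense. The map `h` collapses the gaps,
and `f` sends the gap over `y` into the gap over `T y` with slope `1/2`
(`IDOC.exists_isAssociatedContraction`).
-/

open IntervalDynamics

namespace IntervalDynamics

/-! ### Complexity and branching letters -/

/-- The letters `a` that follow some word `w` of length `k` in `θ` without being the largest letter
to do so, where letters are compared through `r`. -/
def branching {A β : Type*} [LinearOrder β] (r : A → β) (θ : ℕ → A) (k : ℕ) : Set A :=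
  {a | ∃ m m', (∀ j < k, θ (m + j) = θ (m' + j)) ∧ θ (m + k) = a ∧ r a < r (θ (m' + k))}

lemma branching_antitone {A β : Type*} [LinearOrder β] (r : A → β) (θ : ℕ → A) :
    Antitone (branching r θ) := by
  refine antitone_nat_of_succ_le fun k => ?_
  rintro a ⟨m, m', h, ha, hlt⟩
  refine ⟨m + 1, m' + 1, fun j hj => ?_, ?_, ?_⟩
  · simpa only [add_assoc, add_comm 1] using h (j + 1) (by omega)
  · rw [← ha]; congr 1; omega
  · rwa [show m' + 1 + k = m' + (k + 1) by omega]

/-- The factors of length `k + 1` whose last letter is not maximal correspond to the branching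
letters, the others to the factors of length `k`. -/
lemma complexity_succ {A β : Type*} [Finite A] [LinearOrder β] {r : A → β}
    (hr : Function.Injective r) (θ : ℕ → A) (k : ℕ)
    (key : ∀ m m' l l', (∀ j < k, θ (m + j) = θ (m' + j)) → (∀ j < k, θ (l + j) = θ (l' + j)) →
      θ (m + k) = θ (l + k) → r (θ (m + k)) < r (θ (m' + k)) →
      r (θ (l + k)) < r (θ (l' + k)) → ∀ j < k, θ (m + j) = θ (l + j)) :
    complexity θ (k + 1) = complexity θ k + (branching r θ k).ncard := by
  classical
  set F := factors θ (k + 1)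
  set N : Set (Fin (k + 1) → A) := {v | v ∈ F ∧ ∃ v' ∈ F, Fin.init v' = Fin.init v ∧
    r (v (Fin.last k)) < r (v' (Fin.last k))}
  have hNF : N ⊆ F := fun v hv => hv.1
  have hinit : ∀ m : ℕ, (Fin.init (fun j : Fin (k + 1) => θ (m + j)) : Fin k → A)
      = fun j : Fin k => θ (m + j) := fun m => by funext j; simp [Fin.init]
  have hext : ∀ v v' : Fin (k + 1) → A, Fin.init v = Fin.init v' →
      v (Fin.last k) = v' (Fin.last k) → v = v' := by
    intro v v' h1 h2
    rw [← Fin.snoc_init_self v, ← Fin.snoc_init_self v', h1, h2]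
  have hmax : (Fin.init '' (F \ N) : Set (Fin k → A)) = factors θ k := by
    ext w
    constructor
    · rintro ⟨v, ⟨⟨m, rfl⟩, -⟩, rfl⟩
      exact ⟨m, (hinit m).symm⟩
    · rintro ⟨m, rfl⟩
      obtain ⟨v, ⟨hv, hv'⟩, hvm⟩ := Set.exists_max_image
        {v | v ∈ F ∧ Fin.init v = fun j : Fin k => θ (m + j)} (fun v => r (v (Fin.last k)))
        (Set.toFinite _) ⟨_, ⟨m, rfl⟩, hinit m⟩
      refine ⟨v, ⟨hv, ?_⟩, hv'⟩
      rintro ⟨-, v', hv'F, hi, hlt⟩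
      exact absurd (hvm v' ⟨hv'F, hi.trans hv'⟩) (not_le.2 hlt)
  have hmaxinj : Set.InjOn (Fin.init : (Fin (k + 1) → A) → (Fin k → A)) (F \ N) := by
    rintro v ⟨hv, hvN⟩ v' ⟨hv', hvN'⟩ h
    refine hext _ _ h (hr ?_)
    by_contra hne
    rcases lt_or_gt_of_ne hne with hlt | hlt
    · exact hvN ⟨hv, v', hv', h.symm, hlt⟩
    · exact hvN' ⟨hv', v, hv, h, hlt⟩
  have hagree : ∀ m m' : ℕ, (Fin.init (fun j : Fin (k + 1) => θ (m + j)) : Fin k → A)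
      = Fin.init (fun j : Fin (k + 1) => θ (m' + j)) ↔ ∀ j < k, θ (m + j) = θ (m' + j) := by
    intro m m'
    rw [hinit, hinit]
    exact ⟨fun h j hj => congrFun h ⟨j, hj⟩, fun h => funext fun j => h j j.2⟩
  have hlast : (fun v : Fin (k + 1) → A => v (Fin.last k)) '' N = branching r θ k := by
    ext a
    constructor
    · rintro ⟨v, ⟨⟨m, rfl⟩, v', ⟨m', rfl⟩, hi, hlt⟩, rfl⟩
      exact ⟨m, m', (hagree m m').1 hi.symm, by simp, by simpa using hlt⟩
    · rintro ⟨m, m', hi, rfl, hlt⟩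
      exact ⟨_, ⟨⟨m, rfl⟩, _, ⟨m', rfl⟩, ((hagree m m').2 hi).symm, by simpa using hlt⟩, by simp⟩
  have hlastinj : Set.InjOn (fun v : Fin (k + 1) → A => v (Fin.last k)) N := by
    rintro v ⟨⟨m, rfl⟩, v', ⟨m', rfl⟩, hi, hlt⟩ u ⟨⟨l, rfl⟩, u', ⟨l', rfl⟩, hi', hlt'⟩ h
    refine hext _ _ ((hagree m l).2 ?_) h
    exact key m m' l l' ((hagree m m').1 hi.symm) ((hagree l l').1 hi'.symm) (by simpa using h)
      (by simpa using hlt) (by simpa using hlt')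
  calc complexity θ (k + 1) = (F \ N).ncard + N.ncard :=
        (Set.ncard_sdiff_add_ncard_of_subset hNF (Set.toFinite F)).symm
    _ = complexity θ k + (branching r θ k).ncard := by
        rw [← hlast, hlastinj.ncard_image, complexity, ← hmax, hmaxinj.ncard_image]

lemma complexity_zero {A : Type*} [Finite A] (θ : ℕ → A) : complexity θ 0 = 1 := by
  rw [complexity, Set.ncard_eq_one]
  exact ⟨_, Set.eq_singleton_iff_unique_mem.2 ⟨⟨0, rfl⟩, fun _ _ => Subsingleton.elim _ _⟩⟩

lemma eventually_affine_of_antitone {p s : ℕ → ℕ} {n : ℕ} (hn : 1 ≤ n) (hp : p 0 = 1)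
    (hps : ∀ k, p (k + 1) = p k + s k) (hs : Antitone s) (hsn : ∀ k, s k ≤ n - 1) :
    ∃ α β k₀ : ℕ, α < n ∧ 1 ≤ β ∧ 1 ≤ k₀ ∧
      (∀ k, k₀ ≤ k → p k = α * k + β) ∧ (α = n - 1 → β = 1) := by
  obtain ⟨k₁, hk₁⟩ := Nat.sInf_mem (Set.range_nonempty s)
  have hmin : ∀ k, s k₁ ≤ s k := fun k => hk₁ ▸ Nat.sInf_le ⟨k, rfl⟩
  have hlow : ∀ k, s k₁ * k + 1 ≤ p k := by
    intro k
    induction k with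
    | zero => simp [hp]
    | succ k ih => rw [hps, mul_add]; have := hmin k; omega
  have haff : ∀ i, p (k₁ + 1 + i) = p (k₁ + 1) + s k₁ * i := by
    intro i
    induction i with
    | zero => simp
    | succ i ih =>
      have h := le_antisymm (hs (show k₁ ≤ k₁ + 1 + i by omega)) (hmin _)
      rw [← add_assoc, hps, ih, h]; ring
  refine ⟨s k₁, p (k₁ + 1) - s k₁ * (k₁ + 1), k₁ + 1, ?_, ?_, by omega, ?_, ?_⟩
  · have := hsn k₁; omega
  · have := hlow (k₁ + 1); omega
  · intro k hk
    obtain ⟨i, rfl⟩ := Nat.exists_eq_add_of_le hk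
    have := hlow (k₁ + 1)
    rw [haff, mul_add]; omega
  · intro hα
    have hup : ∀ k, p k = s k₁ * k + 1 := by
      intro k
      induction k with
      | zero => simp [hp]
      | succ k ih => rw [hps, ih, mul_add]; have := hmin k; have := hsn k; omega
    rw [hup]; omega

/-! ### Images of cylinders -/

lemma ordConnected_image_of_continuousOn {A : Set UnitIco} {f : UnitIco → UnitIco}
    (hA : A.OrdConnected) (hf : ContinuousOn f A) : (f '' A).OrdConnected := by
  have h1 : (Subtype.val '' A).OrdConnected := by
    refine ⟨?_⟩
    rintro _ ⟨x, hx, rfl⟩ _ ⟨y, hy, rfl⟩ z hz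
    exact ⟨⟨z, x.2.1.trans hz.1, hz.2.trans_lt y.2.2⟩, hA.out hx hy ⟨hz.1, hz.2⟩, rfl⟩
  have h2 : IsPreconnected A :=
    Topology.IsInducing.subtypeVal.isPreconnected_image.1 h1.isPreconnected
  have h3 := ((h2.image f hf).image _ continuous_subtype_val.continuousOn).ordConnected
  refine ⟨fun x hx y hy z hz => ?_⟩
  obtain ⟨w, hw, hwz⟩ := h3.out ⟨x, hx, rfl⟩ ⟨y, hy, rfl⟩ (show (z : ℝ) ∈ _ from ⟨hz.1, hz.2⟩)
  exact Subtype.ext hwz ▸ hw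

variable {n : ℕ} {J : Fin n → Set UnitIco} {f : UnitIco → UnitIco}

/-- The image under `f^k` of the set of points whose coding starts with `w 0, …, w (k-1)`. -/
def cylinderImage (J : Fin n → Set UnitIco) (f : UnitIco → UnitIco) (w : ℕ → Fin n) :
    ℕ → Set UnitIco
  | 0 => Set.univ
  | k + 1 => f '' (cylinderImage J f w k ∩ J (w k))

lemma ordConnected_cylinderImage (hJ : IsIntervalPartition J) (hc : ∀ i, ContinuousOn f (J i))
    (w : ℕ → Fin n) (k : ℕ) : (cylinderImage J f w k).OrdConnected := by
  induction k with
  | zero => exact Set.ordConnected_univ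
  | succ k ih =>
    rw [cylinderImage]
    exact ordConnected_image_of_continuousOn (ih.inter (hJ.ordConnected _))
      ((hc _).mono Set.inter_subset_right)

lemma cylinderImage_congr {w w' : ℕ → Fin n} {k : ℕ} (h : ∀ j < k, w j = w' j) :
    cylinderImage J f w k = cylinderImage J f w' k := by
  induction k with
  | zero => rfl
  | succ k ih =>
    rw [cylinderImage, cylinderImage, ih fun j hj => h j (by omega), h k (by omega)]

lemma IsIntervalPartition.eq_of_mem (hJ : IsIntervalPartition J) {i j : Fin n} {x : UnitIco}
    (hi : x ∈ J i) (hj : x ∈ J j) : i = j :=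
  by_contra fun h => Set.disjoint_left.1 (hJ.disjoint i j h) hi hj

lemma IsIntervalPartition.exists_mem (hJ : IsIntervalPartition J) (x : UnitIco) :
    ∃ i, x ∈ J i := Set.mem_iUnion.1 (hJ.cover ▸ Set.mem_univ x)

/-- Injectivity makes the images of distinct cylinders of the same length disjoint. -/
lemma eq_of_mem_cylinderImage (hJ : IsIntervalPartition J) (hf : Function.Injective f)
    {w w' : ℕ → Fin n} {k : ℕ} {y : UnitIco} (h : y ∈ cylinderImage J f w k)
    (h' : y ∈ cylinderImage J f w' k) : ∀ j < k, w j = w' j := by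
  induction k generalizing y with
  | zero => simp
  | succ k ih =>
    obtain ⟨u, hu, rfl⟩ := h
    obtain ⟨u', hu', he⟩ := h'
    obtain rfl := hf he
    intro j hj
    rcases Nat.lt_succ_iff_lt_or_eq.1 hj with hj | rfl
    · exact ih hu.1 hu'.1 j hj
    · exact hJ.eq_of_mem hu.2 hu'.2

lemma IsCodingOf.iterate_mem_cylinderImage {x : UnitIco} {θ : ℕ → Fin n}
    (hθ : IsCodingOf J f x θ) (m k : ℕ) :
    f^[m + k] x ∈ cylinderImage J f (fun j => θ (m + j)) k := by
  induction k with
  | zero => trivial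
  | succ k ih =>
    exact ⟨_, ⟨ih, hθ (m + k)⟩, (Function.iterate_succ_apply' f (m + k) x).symm⟩

/-- Two disjoint intervals are ordered like any two of their points. -/
lemma IsIntervalPartition.lt_of_lt (hJ : IsIntervalPartition J) {i j : Fin n} (hij : i ≠ j)
    {u v u' v' : UnitIco} (hu : u ∈ J i) (hv : v ∈ J j) (hu' : u' ∈ J i) (hv' : v' ∈ J j)
    (h : u < v) : u' < v' := by
  by_contra! hle
  have hd := Set.disjoint_left.1 (hJ.disjoint i j hij)
  rcases le_total u v' with h1 | h1
  · exact hd ((hJ.ordConnected i).out hu hu' ⟨h1, hle⟩) hv'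
  · exact hd hu ((hJ.ordConnected j).out hv' hv ⟨h1, h.le⟩)

/-- A point of each interval of a partition, used to compare the intervals by position. -/
noncomputable def IsIntervalPartition.rep (hJ : IsIntervalPartition J) (i : Fin n) : UnitIco :=
  (hJ.nontrivial i).nonempty.some

lemma IsIntervalPartition.rep_mem (hJ : IsIntervalPartition J) (i : Fin n) : hJ.rep i ∈ J i :=
  (hJ.nontrivial i).nonempty.some_mem

lemma IsIntervalPartition.rep_injective (hJ : IsIntervalPartition J) :
    Function.Injective hJ.rep := fun i j h =>
  hJ.eq_of_mem (hJ.rep_mem i) (h ▸ hJ.rep_mem j)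

lemma IsIntervalPartition.rep_lt_iff (hJ : IsIntervalPartition J) {i j : Fin n} (hij : i ≠ j)
    {u v : UnitIco} (hu : u ∈ J i) (hv : v ∈ J j) : hJ.rep i < hJ.rep j ↔ u < v :=
  ⟨hJ.lt_of_lt hij (hJ.rep_mem i) (hJ.rep_mem j) hu hv,
    hJ.lt_of_lt hij hu hv (hJ.rep_mem i) (hJ.rep_mem j)⟩

/-- For an injective map that is continuous on each piece, a letter `i` can branch after one word
of each length only: the images of two cylinders that both meet `J i` and the part of `[0,1)`
above `J i` cannot be disjoint. -/
lemma IsCodingOf.complexity_succ (hJ : IsIntervalPartition J) (hc : ∀ i, ContinuousOn f (J i))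
    (hf : Function.Injective f) {x : UnitIco} {θ : ℕ → Fin n} (hθ : IsCodingOf J f x θ) (k : ℕ) :
    complexity θ (k + 1) = complexity θ k + (branching hJ.rep θ k).ncard := by
  refine IntervalDynamics.complexity_succ hJ.rep_injective θ k ?_
  intro m m' l l' hm hl hml hlt hlt'
  have aux : ∀ m m' l : ℕ, (∀ j < k, θ (m + j) = θ (m' + j)) → θ (m + k) = θ (l + k) →
      hJ.rep (θ (m + k)) < hJ.rep (θ (m' + k)) → f^[m + k] x ≤ f^[l + k] x →
      f^[l + k] x ∈ cylinderImage J f (fun j => θ (m + j)) k := by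
    intro m m' l hm hml hlt hle
    have h1 := hθ.iterate_mem_cylinderImage m k
    have h2 := hθ.iterate_mem_cylinderImage m' k
    rw [← cylinderImage_congr hm] at h2
    refine (ordConnected_cylinderImage hJ hc _ k).out h1 h2 ⟨hle, le_of_lt ?_⟩
    refine (hJ.rep_lt_iff (fun h => ?_) (hml ▸ hθ (l + k)) (hθ (m' + k))).1 hlt
    rw [h] at hlt
    exact lt_irrefl _ hlt
  rcases le_total (f^[m + k] x) (f^[l + k] x) with hle | hle
  · exact eq_of_mem_cylinderImage hJ hf (aux m m' l hm hml hlt hle)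
      (hθ.iterate_mem_cylinderImage l k)
  · exact eq_of_mem_cylinderImage hJ hf (hθ.iterate_mem_cylinderImage m k)
      (aux l l' m hl hml.symm hlt' hle)

/-- The letter of the rightmost interval of a partition. -/
lemma IsIntervalPartition.exists_top (hJ : IsIntervalPartition J) :
    ∃ t : Fin n, ∀ i, hJ.rep i < hJ.rep t ↔ i ≠ t := by
  obtain ⟨i₀, -⟩ := hJ.exists_mem ⟨0, le_rfl, one_pos⟩
  have : Nonempty (Fin n) := ⟨i₀⟩
  obtain ⟨t, ht⟩ := Finite.exists_max hJ.rep
  exact ⟨t, fun i => ⟨fun h hi => by simp [hi] at h,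
    fun h => lt_of_le_of_ne (ht i) (hJ.rep_injective.ne h)⟩⟩

lemma IsIntervalPartition.ncard_branching_le (hJ : IsIntervalPartition J) (θ : ℕ → Fin n) (k : ℕ) :
    (branching hJ.rep θ k).ncard ≤ n - 1 := by
  obtain ⟨t, ht⟩ := hJ.exists_top
  have hsub : branching hJ.rep θ k ⊆ {t}ᶜ := by
    rintro a ⟨m, m', -, -, hlt⟩ rfl
    by_cases h : θ (m' + k) = a
    · simp [h] at hlt
    · exact lt_asymm hlt ((ht _).2 h)
  refine (Set.ncard_le_ncard hsub (Set.toFinite _)).trans (le_of_eq ?_)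
  rw [Set.ncard_compl, Set.ncard_singleton, Nat.card_fin]

lemma IsPC.continuousOn (hf : IsPC J f) (i : Fin n) : ContinuousOn f (J i) := by
  obtain ⟨lam, h0, -, h⟩ := hf.contracts
  refine (LipschitzOnWith.of_dist_le_mul (K := ⟨lam, h0.le⟩) fun x hx y hy => ?_).continuousOn
  exact h i x hx y hy

lemma IsPC.complexity_eventually_affine (hf : IsPC J f) (hinj : Function.Injective f)
    {θ : ℕ → Fin n} (hθ : IsNaturalCoding J f θ) :
    ∃ α β k₀ : ℕ, α < n ∧ 1 ≤ β ∧ 1 ≤ k₀ ∧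
      (∀ k, k₀ ≤ k → complexity θ k = α * k + β) ∧ (α = n - 1 → β = 1) := by
  obtain ⟨x, hx⟩ := hθ
  have hJ := hf.partition
  refine eventually_affine_of_antitone (s := fun k => (branching hJ.rep θ k).ncard) ?_
    (complexity_zero θ) (hx.complexity_succ hJ hf.continuousOn hinj) ?_
    (hJ.ncard_branching_le θ)
  · exact (Nat.zero_le _).trans_lt (θ 0).2
  · exact fun k l hkl => Set.ncard_le_ncard (branching_antitone _ _ hkl) (Set.toFinite _)

/-! ### Interval exchanges: pieces and endpoints -/

section IntervalExchange

variable {n : ℕ} {J : Fin n → Set UnitIco} {T : UnitIco → UnitIco}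

/-- The left endpoints of the intervals of a partition, `0` included. -/
def leftEndpoints (J : Fin n → Set UnitIco) : Set UnitIco :=
  {x | ∃ i, IsLeast (J i) x}

lemma finite_leftEndpoints (J : Fin n → Set UnitIco) : (leftEndpoints J).Finite := by
  have : leftEndpoints J = ⋃ i, {x | IsLeast (J i) x} := by ext; simp [leftEndpoints]
  rw [this]
  exact Set.finite_iUnion fun i =>
    Set.Subsingleton.finite fun x hx y hy => IsLeast.unique hx hy

lemma mem_divisionPoints_iff {x : UnitIco} :
    x ∈ divisionPoints J ↔ x ∈ leftEndpoints J ∧ x ≠ ⟨0, le_rfl, one_pos⟩ := by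
  refine ⟨fun h => ⟨h.2, fun hx => ?_⟩, fun h => ⟨lt_of_le_of_ne x.2.1 fun hx => ?_, h.1⟩⟩
  · have := h.1
    simp [hx] at this
  · exact h.2 (Subtype.ext hx.symm)

namespace IsStandardIET

lemma exists_eq (hT : IsStandardIET J T) (i : Fin n) :
    ∃ (a : UnitIco) (c : ℝ), (a : ℝ) < c ∧ c ≤ 1 ∧ IsLeast (J i) a ∧
      ∀ x : UnitIco, x ∈ J i ↔ a ≤ x ∧ (x : ℝ) < c := by
  obtain ⟨a, c, h0, hac, hc, h⟩ := hT.halfOpen i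
  have hmem : ∀ x : UnitIco, x ∈ J i ↔ a ≤ (x : ℝ) ∧ (x : ℝ) < c := fun x => by
    rw [← Subtype.val_injective.mem_set_image, h, Set.mem_ofPred_eq]
  exact ⟨⟨a, h0, hac.trans_le hc⟩, c, hac, hc,
    ⟨(hmem _).2 ⟨le_rfl, hac⟩, fun x hx => ((hmem x).1 hx).1⟩, hmem⟩

lemma sub_eq (hT : IsStandardIET J T) {i : Fin n} {x y : UnitIco} (hx : x ∈ J i) (hy : y ∈ J i) :
    (T x : ℝ) - T y = x - y := by
  obtain ⟨b, hb⟩ := hT.translation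
  rw [hb i x hx, hb i y hy]
  ring

lemma zero_mem_leftEndpoints (hT : IsStandardIET J T) :
    (⟨0, le_rfl, one_pos⟩ : UnitIco) ∈ leftEndpoints J := by
  obtain ⟨i, hi⟩ := hT.partition.exists_mem ⟨0, le_rfl, one_pos⟩
  exact ⟨i, hi, fun x _ => x.2.1⟩

/-- The right endpoint of a piece, if less than `1`, is the left endpoint of another piece. -/
lemma mem_leftEndpoints_of_right (hT : IsStandardIET J T) {i : Fin n} {a c : UnitIco} (hac : a < c)
    (h : ∀ x, x ∈ J i ↔ a ≤ x ∧ (x : ℝ) < c) : c ∈ leftEndpoints J := by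
  obtain ⟨j, hj⟩ := hT.partition.exists_mem c
  obtain ⟨a', c', -, -, hl, h'⟩ := hT.exists_eq j
  rcases eq_or_lt_of_le ((h' c).1 hj).1 with he | hlt
  · exact ⟨j, he ▸ hl⟩
  · exfalso
    have h1 : max a a' ∈ J i := (h _).2 ⟨le_max_left _ _, max_lt hac hlt⟩
    have h2 : max a a' ∈ J j :=
      (h' _).2 ⟨le_max_right _ _, lt_of_lt_of_le (b := (c : ℝ)) (max_lt hac hlt) ((h' c).1 hj).2.le⟩
    obtain rfl := hT.partition.eq_of_mem h1 h2
    exact lt_irrefl _ ((h c).1 hj).2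

/-- A half-open interval without left endpoints in its interior lies in one piece. -/
lemma exists_piece_of_forall_notMem (hT : IsStandardIET J T) {e : UnitIco} {ε : ℝ}
    (h : ∀ d ∈ leftEndpoints J, e < d → (e : ℝ) + ε ≤ d) :
    ∃ i, e ∈ J i ∧ ∀ w : UnitIco, e ≤ w → (w : ℝ) < e + ε → w ∈ J i := by
  obtain ⟨i, hi⟩ := hT.partition.exists_mem e
  obtain ⟨a, c, hac, hc, -, hJ⟩ := hT.exists_eq i
  have he := (hJ e).1 hi
  refine ⟨i, hi, fun w hw hwε => (hJ w).2 ⟨he.1.trans hw, ?_⟩⟩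
  by_contra! hcw
  have hc1 : c < 1 := hcw.trans_lt w.2.2
  have hd := hT.mem_leftEndpoints_of_right (a := a) (c := ⟨c, a.2.1.trans hac.le, hc1⟩) hac hJ
  have := h _ hd he.2
  simp only at this
  linarith

/-- A point that is not a left endpoint is interior to its piece. -/
lemma exists_nhds_piece (hT : IsStandardIET J T) {z : UnitIco} (hz : z ∉ leftEndpoints J) :
    ∃ i, ∃ ε > 0, ε ≤ (z : ℝ) ∧ (z : ℝ) + ε ≤ 1 ∧
      ∀ w : UnitIco, |(w : ℝ) - z| < ε → w ∈ J i ∧ w ∉ leftEndpoints J := by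
  obtain ⟨i, hi⟩ := hT.partition.exists_mem z
  obtain ⟨a, c, hac, hc, hl, hJ⟩ := hT.exists_eq i
  have he := (hJ z).1 hi
  have haz : (a : ℝ) < z := lt_of_le_of_ne he.1 fun h => hz (Subtype.ext h ▸ ⟨i, hl⟩)
  have ha := a.2.1
  refine ⟨i, min (z - a) (c - z), lt_min (by linarith) (by linarith [he.2]), ?_, ?_, ?_⟩
  · exact (min_le_left _ _).trans (by linarith)
  · linarith [min_le_right ((z : ℝ) - a) (c - z)]
  · intro w hw
    have := abs_lt.1 hw
    have h1 := min_le_left ((z : ℝ) - a) (c - z)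
    have h2 := min_le_right ((z : ℝ) - a) (c - z)
    have hwi : w ∈ J i := (hJ w).2 ⟨show (a : ℝ) ≤ w by linarith, by linarith⟩
    refine ⟨hwi, ?_⟩
    rintro ⟨j, hj⟩
    obtain rfl := hT.partition.eq_of_mem hwi hj.1
    have : (w : ℝ) ≤ a := hj.2 hl.1
    linarith

/-- Near a point that is not a left endpoint, `T` and its inverse are translations. -/
lemma exists_local_translation (hT : IsStandardIET J T) {z : UnitIco}
    (hz : z ∉ leftEndpoints J) : ∃ ε > 0, ∀ w : UnitIco,
      (|(w : ℝ) - z| < ε ∨ |(T w : ℝ) - T z| < ε) → (T w : ℝ) - T z = w - z := by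
  obtain ⟨i, ε, hε, h0, h1, h⟩ := hT.exists_nhds_piece hz
  have hzi : z ∈ J i := (h z (by simpa using hε)).1
  refine ⟨ε, hε, fun w hw => ?_⟩
  rcases hw with hw | hw
  · exact hT.sub_eq (h w hw).1 hzi
  · have hw' := abs_lt.1 hw
    obtain ⟨u, hu⟩ : ∃ u : UnitIco, (u : ℝ) = z + (T w - T z) :=
      ⟨⟨z + (T w - T z), by linarith, by linarith⟩, rfl⟩
    have hui : u ∈ J i := (h u (by rw [hu]; simpa using hw)).1
    have huw : T u = T w := Subtype.ext (by linarith [hT.sub_eq hui hzi])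
    rw [← hT.bijective.1 huw]
    linarith [hT.sub_eq hui hzi]

/-- At a point `z` that is not a left endpoint, a set that is invariant at such points contains an
interval to the left of `z` if and only if it contains one to the left of `T z`. -/
lemma left_germ_iff (hT : IsStandardIET J T) {W : Set UnitIco}
    (hW : ∀ z ∉ leftEndpoints J, z ∈ W ↔ T z ∈ W) {z : UnitIco} (hz : z ∉ leftEndpoints J) :
    (∃ ε > 0, ∀ w : UnitIco, (z : ℝ) - ε < w → w < z → w ∈ W) ↔
      ∃ ε > 0, ∀ w : UnitIco, (T z : ℝ) - ε < w → w < T z → w ∈ W := by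
  obtain ⟨i, δ, hδ, h0, h1, h⟩ := hT.exists_nhds_piece hz
  have hzi : z ∈ J i := (h z (by simpa using hδ)).1
  constructor
  · rintro ⟨ε, hε, hw⟩
    refine ⟨min δ ε, lt_min hδ hε, fun w hw1 hw2 => ?_⟩
    have hw2' : (w : ℝ) < T z := hw2
    have h2 := min_le_left δ ε
    have h3 := min_le_right δ ε
    obtain ⟨v, hv⟩ : ∃ v : UnitIco, (v : ℝ) = z - (T z - w) :=
      ⟨⟨z - (T z - w), by linarith, by linarith⟩, rfl⟩
    obtain ⟨hvi, hvL⟩ := h v (abs_lt.2 ⟨by linarith, by linarith⟩)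
    have hTv : T v = w := Subtype.ext (by linarith [hT.sub_eq hvi hzi])
    exact hTv ▸ (hW v hvL).1 (hw v (by linarith) (show (v : ℝ) < z by linarith))
  · rintro ⟨ε, hε, hw⟩
    refine ⟨min δ ε, lt_min hδ hε, fun w hw1 hw2 => ?_⟩
    have hw2' : (w : ℝ) < z := hw2
    have h2 := min_le_left δ ε
    have h3 := min_le_right δ ε
    obtain ⟨hwi, hwL⟩ := h w (abs_lt.2 ⟨by linarith, by linarith⟩)
    have := hT.sub_eq hwi hzi
    exact (hW w hwL).2 (hw _ (by linarith) (show (T w : ℝ) < T z by linarith))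

/-- The inverse of an interval exchange is an interval exchange. -/
lemma symm {e : UnitIco ≃ UnitIco} (hT : IsStandardIET J e) :
    IsStandardIET (fun i => e '' J i) e.symm := by
  have hho : ∀ i, ∃ a c : ℝ, 0 ≤ a ∧ a < c ∧ c ≤ 1 ∧
      e '' J i = {x : UnitIco | a ≤ (x : ℝ) ∧ (x : ℝ) < c} := by
    intro i
    obtain ⟨a, c, hac, hc, hl, hJ⟩ := hT.exists_eq i
    have hc' : (e a : ℝ) + (c - a) ≤ 1 := by
      by_contra! hlt
      have ha1 := (e a).2.2
      obtain ⟨u, hu⟩ : ∃ u : UnitIco, (u : ℝ) = a + (1 - e a) :=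
        ⟨⟨a + (1 - e a), by linarith [a.2.1], by linarith⟩, rfl⟩
      have hui : u ∈ J i := (hJ u).2 ⟨show (a : ℝ) ≤ u by linarith, by linarith⟩
      have := hT.sub_eq hui hl.1
      linarith [(e u).2.2]
    refine ⟨e a, e a + (c - a), (e a).2.1, by linarith, hc', ?_⟩
    ext x
    constructor
    · rintro ⟨u, hu, rfl⟩
      have h1 := hT.sub_eq hu hl.1
      have h2 : (a : ℝ) ≤ u := ((hJ u).1 hu).1
      have h3 := ((hJ u).1 hu).2
      exact ⟨by linarith, by linarith⟩
    · rintro ⟨h1, h2⟩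
      obtain ⟨u, hu⟩ : ∃ u : UnitIco, (u : ℝ) = a + (x - e a) :=
        ⟨⟨a + (x - e a), by linarith [a.2.1], by linarith⟩, rfl⟩
      have hui : u ∈ J i := (hJ u).2 ⟨show (a : ℝ) ≤ u by linarith, by linarith⟩
      exact ⟨u, hui, Subtype.ext (by linarith [hT.sub_eq hui hl.1])⟩
  refine ⟨⟨fun i => ?_, fun i => ?_, fun i j hij => ?_, ?_⟩, e.symm.bijective,
    fun i => ?_, ?_⟩
  · obtain ⟨a, c, -, -, -, h⟩ := hho i
    simp only [h]
    exact ⟨fun x hx y hy z hz => ⟨hx.1.trans hz.1, lt_of_le_of_lt (show (z : ℝ) ≤ y from hz.2) hy.2⟩⟩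
  · exact (hT.partition.nontrivial i).image e.injective
  · exact (Set.disjoint_image_iff e.injective).2 (hT.partition.disjoint i j hij)
  · rw [← Set.image_iUnion, hT.partition.cover, Set.image_univ, e.range_eq_univ]
  · obtain ⟨a, c, h0, hac, hc, h⟩ := hho i
    refine ⟨a, c, h0, hac, hc, ?_⟩
    ext x
    refine ⟨?_, fun hx => ⟨⟨x, h0.trans hx.1, hx.2.trans_le hc⟩, ?_, rfl⟩⟩
    · rintro ⟨u, hu, rfl⟩
      rw [h] at hu
      exact hu
    · rw [h]
      exact hx
  · obtain ⟨b, hb⟩ := hT.translation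
    refine ⟨fun i => -b i, ?_⟩
    rintro i _ ⟨u, hu, rfl⟩
    simp [hb i u hu]

lemma leftEndpoints_symm {e : UnitIco ≃ UnitIco} (hT : IsStandardIET J e) :
    leftEndpoints (fun i => e '' J i) = e '' leftEndpoints J := by
  have hle : ∀ {i a}, IsLeast (J i) a → IsLeast (e '' J i) (e a) := by
    rintro i a ha
    refine ⟨⟨a, ha.1, rfl⟩, ?_⟩
    rintro _ ⟨u, hu, rfl⟩
    have h1 := hT.sub_eq hu ha.1
    have h2 : (a : ℝ) ≤ u := ha.2 hu
    exact show (e a : ℝ) ≤ e u by linarith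
  ext x
  constructor
  · rintro ⟨i, hi⟩
    obtain ⟨a, -, -, -, hl, -⟩ := hT.exists_eq i
    exact ⟨a, ⟨i, hl⟩, (hle hl).unique hi⟩
  · rintro ⟨a, ⟨i, hi⟩, rfl⟩
    exact ⟨i, hle hi⟩

/-! ### Gaps and periodic points -/

/-- Let `W` be a set that is invariant under `T` at all points but the left endpoints, and let
`e ∉ W` be the left end of an interval contained in `W`. If the forward orbit of `e` avoids the
left endpoints, then all its points are left ends of intervals of a common length contained in `W`, so
that the orbit is finite. -/
lemma exists_iterate_eq_of_gap (hT : IsStandardIET J T) {W : Set UnitIco}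
    (hW : ∀ z ∉ leftEndpoints J, z ∈ W ↔ T z ∈ W) {e : UnitIco} (heW : e ∉ W) {ε : ℝ}
    (hε : 0 < ε) (heε : (e : ℝ) + ε ≤ 1)
    (hgap : ∀ w : UnitIco, e < w → (w : ℝ) < e + ε → w ∈ W)
    (he : ∀ k, T^[k] e ∉ leftEndpoints J) : ∃ k l, k < l ∧ T^[k] e = T^[l] e := by
  -- Each left endpoint lies in at most one component of `W`, hence the finitely many pieces into
  -- which left endpoints cut components are not shorter than some `δ > 0`.
  obtain ⟨δ, hδ0, hδ⟩ : ∃ δ : ℝ, 0 < δ ∧ ∀ d ∈ leftEndpoints J, ∀ u : UnitIco, u ∉ W → u < d →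
      (∀ w, u < w → w ≤ d → w ∈ W) → δ ≤ (d : ℝ) - u := by
    have : ∀ᶠ δ : ℝ in nhdsWithin 0 (Set.Ioi 0), ∀ d ∈ leftEndpoints J, ∀ u : UnitIco, u ∉ W →
        u < d → (∀ w, u < w → w ≤ d → w ∈ W) → δ ≤ (d : ℝ) - u := by
      rw [Filter.eventually_all_finite (finite_leftEndpoints J)]
      intro d _
      by_cases hex : ∃ u : UnitIco, u ∉ W ∧ u < d ∧ ∀ w, u < w → w ≤ d → w ∈ W
      · obtain ⟨u, hu, hud, huw⟩ := hex
        have hpos : (0 : ℝ) < d - u := sub_pos.2 hud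
        filter_upwards [Ioc_mem_nhdsGT hpos] with δ hδ u' hu' hud' huw'
        rcases lt_trichotomy u u' with h | h | h
        · exact absurd (huw u' h hud'.le) hu'
        · exact h ▸ hδ.2
        · exact absurd (huw' u h hud.le) hu
      · exact Filter.Eventually.of_forall fun δ u h1 h2 h3 => absurd ⟨u, h1, h2, h3⟩ hex
    obtain ⟨δ, h1, h2⟩ := (this.and self_mem_nhdsWithin).exists
    exact ⟨δ, h2, h1⟩
  set η := min δ ε
  have hη0 : 0 < η := lt_min hδ0 hε
  have main : ∀ k, T^[k] e ∉ W ∧ ((T^[k] e : UnitIco) : ℝ) + η ≤ 1 ∧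
      ∀ w : UnitIco, T^[k] e < w → (w : ℝ) < T^[k] e + η → w ∈ W := by
    intro k
    induction k with
    | zero =>
      refine ⟨heW, ?_, fun w hw hw' => hgap w hw ?_⟩
      · simp only [Function.iterate_zero, id]
        linarith [min_le_right δ ε]
      · simp only [Function.iterate_zero, id] at hw'
        linarith [min_le_right δ ε]
    | succ k ih =>
      rw [Function.iterate_succ_apply']
      obtain ⟨h1, h2, h3⟩ := ih
      have hk := he k
      set u := T^[k] e
      obtain ⟨i, hui, hi⟩ := hT.exists_piece_of_forall_notMem (e := u) (ε := η) (by
        intro d hd hud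
        by_contra! hlt
        have := hδ d hd u h1 hud fun w hw hwd =>
          h3 w hw (lt_of_le_of_lt (show (w : ℝ) ≤ d from hwd) hlt)
        linarith [min_le_left δ ε])
      refine ⟨fun h => h1 ((hW u hk).2 h), ?_, fun w hw hwη => ?_⟩
      · by_contra! hlt
        have hTu := (T u).2.2
        obtain ⟨v, hv⟩ : ∃ v : UnitIco, (v : ℝ) = u + (1 - T u) :=
          ⟨⟨u + (1 - T u), by linarith [u.2.1], by linarith⟩, rfl⟩
        have := hT.sub_eq (hi v (show (u : ℝ) ≤ v by linarith) (by linarith)) hui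
        linarith [(T v).2.2]
      · have hw' : (T u : ℝ) < w := hw
        obtain ⟨v, hv⟩ : ∃ v : UnitIco, (v : ℝ) = u + (w - T u) :=
          ⟨⟨u + (w - T u), by linarith [u.2.1], by linarith⟩, rfl⟩
        have hvi := hi v (show (u : ℝ) ≤ v by linarith) (by linarith)
        have hvw : T v = w := Subtype.ext (by linarith [hT.sub_eq hvi hui])
        have huv : u < v := show (u : ℝ) < v by linarith
        have hvW := h3 v huv (by linarith)
        have hvL : v ∉ leftEndpoints J := by
          rintro ⟨j, hj⟩
          obtain rfl := hT.partition.eq_of_mem hvi hj.1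
          exact absurd (hj.2 hui) (not_le.2 huv)
        exact hvw ▸ (hW v hvL).1 hvW
  -- Two iterates in the same cell of length `η` coincide, and there are finitely many cells.
  have hmaps : Set.MapsTo (fun k => ⌊((T^[k] e : UnitIco) : ℝ) / η⌋) Set.univ
      (Set.Icc 0 ⌊1 / η⌋) := by
    intro k _
    refine ⟨Int.floor_nonneg.2 (div_nonneg (T^[k] e).2.1 hη0.le), Int.floor_le_floor ?_⟩
    exact div_le_div_of_nonneg_right (T^[k] e).2.2.le hη0.le
  obtain ⟨k, -, l, -, hkl, hfl⟩ := Set.infinite_univ.exists_ne_map_eq_of_mapsTo hmaps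
    (Set.finite_Icc _ _)
  have hcell : ∀ k l : ℕ, ⌊((T^[k] e : UnitIco) : ℝ) / η⌋ = ⌊((T^[l] e : UnitIco) : ℝ) / η⌋ →
      ¬ T^[k] e < T^[l] e := by
    intro k l h hlt
    have h1 := Int.abs_sub_lt_one_of_floor_eq_floor h
    rw [← sub_div, abs_div, abs_of_pos hη0, div_lt_one hη0] at h1
    refine (main l).1 ((main k).2.2 _ hlt ?_)
    linarith [(abs_lt.1 h1).1]
  have heq : T^[k] e = T^[l] e :=
    le_antisymm (not_lt.1 (hcell l k hfl.symm)) (not_lt.1 (hcell k l hfl))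
  rcases lt_or_gt_of_ne hkl with h | h
  · exact ⟨k, l, h, heq⟩
  · exact ⟨l, k, h, heq.symm⟩

end IsStandardIET

lemma iterate_sub_eq_of_iterate_eq (hT : Function.Injective T) {x : UnitIco} {k l : ℕ}
    (hkl : k < l) (h : T^[k] x = T^[l] x) : T^[l - k] x = x := by
  refine hT.iterate k ?_
  rw [← Function.iterate_add_apply, h]
  congr 2
  omega

lemma finite_orbit_of_isPeriodicPt {x : UnitIco} {m : ℕ} (hm : 0 < m)
    (h : T^[m] x = x) : (orbit T x).Finite := by
  refine ((Set.finite_lt_nat m).image fun k => T^[k] x).subset ?_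
  rintro _ ⟨k, rfl⟩
  refine ⟨k % m, Nat.mod_lt _ hm, ?_⟩
  exact Function.IsPeriodicPt.iterate_mod_apply (f := T) (n := m) h k

namespace IDOC

lemma iterate_ne (hI : IDOC J T) {d d' : UnitIco}
    (hd : d ∈ divisionPoints J) (hd' : d' ∈ divisionPoints J) {m : ℕ} (hm : 0 < m) :
    T^[m] d ≠ d' := by
  rintro h
  by_cases hdd : d = d'
  · exact hI.infinite d hd (finite_orbit_of_isPeriodicPt hm (h.trans hdd.symm))
  · exact Set.disjoint_left.1 (hI.disjoint d hd d' hd' hdd) ⟨m, rfl⟩ ⟨0, h.symm⟩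

/-- The point `0` is the image of a division point. -/
lemma exists_apply_eq_zero (hI : IDOC J T) (hT : IsStandardIET J T) (hn : 2 ≤ n) :
    ∃ d ∈ divisionPoints J, T d = ⟨0, le_rfl, one_pos⟩ := by
  obtain ⟨z, hz⟩ := hT.bijective.2 ⟨0, le_rfl, one_pos⟩
  obtain ⟨i, hi⟩ := hT.partition.exists_mem z
  obtain ⟨a, c, hac, hc, hl, hJ⟩ := hT.exists_eq i
  have hza : z = a := by
    have h1 := hT.sub_eq hi hl.1
    rw [hz] at h1
    have h2 := (T a).2.1
    exact le_antisymm (show (z : ℝ) ≤ a by simp only at h1; linarith) (hl.2 hi)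
  refine ⟨z, mem_divisionPoints_iff.2 ⟨⟨i, hza ▸ hl⟩, ?_⟩, hz⟩
  -- If `T 0 = 0`, the right endpoint `c < 1` of the first piece is the image of a left endpoint.
  intro hz0
  have hc1 : c < 1 := by
    by_contra! hc1
    have : ∀ j, j = i := fun j => by
      have hj := hT.partition.rep_mem j
      refine hT.partition.eq_of_mem hj ((hJ _).2 ⟨?_, ?_⟩)
      · rw [← hza, hz0]; exact (hT.partition.rep j).2.1
      · exact (hT.partition.rep j).2.2.trans_le hc1
    have h0 := this ⟨0, by omega⟩
    have h1 := this ⟨1, by omega⟩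
    rw [← h1] at h0
    simp at h0
  obtain ⟨p, hp⟩ : ∃ p : UnitIco, (p : ℝ) = c := ⟨⟨c, a.2.1.trans hac.le, hc1⟩, rfl⟩
  have hap : a < p := show (a : ℝ) < p by linarith
  have hpL := hT.mem_leftEndpoints_of_right hap (hp ▸ hJ)
  have hp0 : p ≠ ⟨0, le_rfl, one_pos⟩ := by
    rw [← hz0, hza]; exact hap.ne'
  obtain ⟨q, hq⟩ := hT.bijective.2 p
  obtain ⟨j, hj⟩ := hT.partition.exists_mem q
  obtain ⟨a', c', hac', hc', hl', hJ'⟩ := hT.exists_eq j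
  have hqa : q = a' := by
    by_contra hne
    have hlt : (a' : ℝ) < q := lt_of_le_of_ne (hl'.2 hj) fun h => hne (Subtype.ext h.symm)
    have hp1 : (0 : ℝ) < p := lt_of_le_of_lt a.2.1 hap
    set s := min ((q : ℝ) - a') p
    have hs0 : 0 < s := lt_min (by linarith) hp1
    have hs1 : s ≤ q - a' := min_le_left _ _
    have hs2 : s ≤ p := min_le_right _ _
    obtain ⟨u, hu⟩ : ∃ u : UnitIco, (u : ℝ) = q - s :=
      ⟨⟨q - s, by linarith [a'.2.1], by linarith [q.2.2]⟩, rfl⟩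
    obtain ⟨v, hv⟩ : ∃ v : UnitIco, (v : ℝ) = p - s :=
      ⟨⟨p - s, by linarith, by linarith [p.2.2]⟩, rfl⟩
    have huj : u ∈ J j :=
      (hJ' u).2 ⟨show (a' : ℝ) ≤ u by linarith, by linarith [((hJ' q).1 hj).2]⟩
    have hvi : v ∈ J i := (hJ v).2 ⟨by rw [← hza, hz0]; exact v.2.1, by linarith⟩
    have h1 := hT.sub_eq huj hj
    have h2 := hT.sub_eq hvi hi
    rw [hz, hz0] at h2
    rw [hq] at h1
    simp only at h2
    have huv : u = v := hT.bijective.1 (Subtype.ext (by linarith))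
    have hqp : q = p := Subtype.ext (by rw [huv] at hu; linarith)
    obtain ⟨j', hj'⟩ := hpL
    have := hT.partition.eq_of_mem hj (hqp ▸ hj'.1)
    exact absurd (hj'.2 (this ▸ hl'.1)) (not_le.2 (hqp ▸ hlt))
  refine hI.iterate_ne (d := q) (d' := p) (m := 1)
    (mem_divisionPoints_iff.2 ⟨⟨j, hqa ▸ hl'⟩, ?_⟩) (mem_divisionPoints_iff.2 ⟨hpL, hp0⟩)
    one_pos hq
  rintro h
  rw [h, ← hz0, hz] at hq
  exact hp0 hq.symm

lemma iterate_ne_of_mem_leftEndpoints (hI : IDOC J T) (hT : IsStandardIET J T) (hn : 2 ≤ n)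
    {a d : UnitIco} (ha : a ∈ leftEndpoints J) (hd : d ∈ divisionPoints J) {m : ℕ} (hm : 0 < m) :
    T^[m] a ≠ d := by
  by_cases h0 : a = ⟨0, le_rfl, one_pos⟩
  · obtain ⟨d₀, hd₀, hT0⟩ := hI.exists_apply_eq_zero hT hn
    rw [h0, ← hT0, ← Function.iterate_succ_apply]
    exact hI.iterate_ne hd₀ hd m.succ_pos
  · exact hI.iterate_ne (mem_divisionPoints_iff.2 ⟨ha, h0⟩) hd hm

/-- There are no periodic points: otherwise, move a periodic orbit to the left until one of its
points is a left endpoint. -/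
lemma iterate_ne_self (hI : IDOC J T) (hT : IsStandardIET J T) (hn : 2 ≤ n) (e : UnitIco) {m : ℕ}
    (hm : 0 < m) : T^[m] e ≠ e := by
  intro he
  choose i hi using fun k => hT.partition.exists_mem (T^[k] e)
  choose a c hac hc hl hJ using fun k => hT.exists_eq (i k)
  obtain ⟨k, hk, hmin⟩ := Finset.exists_min_image (Finset.range m)
    (fun k => ((T^[k] e : UnitIco) : ℝ) - a k) ⟨0, Finset.mem_range.2 hm⟩
  set t := ((T^[k] e : UnitIco) : ℝ) - a k with ht
  have ht0 : 0 ≤ t := sub_nonneg.2 (hl k |>.2 (hi k))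
  have h0 := hmin 0 (Finset.mem_range.2 hm)
  simp only [Function.iterate_zero, id] at h0
  obtain ⟨u, hu⟩ : ∃ u : UnitIco, (u : ℝ) = e - t :=
    ⟨⟨e - t, by linarith [(a 0).2.1], by linarith [e.2.2]⟩, rfl⟩
  have hmem : ∀ j < m, ∀ v : UnitIco, (v : ℝ) = T^[j] e - t → v ∈ J (i j) := by
    intro j hj v hv
    have := hmin j (Finset.mem_range.2 hj)
    have h2 := ((hJ j _).1 (hi j)).2
    exact (hJ j v).2 ⟨show ((a j : UnitIco) : ℝ) ≤ v by linarith, by linarith⟩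
  have hiter : ∀ j ≤ m, ((T^[j] u : UnitIco) : ℝ) = T^[j] e - t := by
    intro j
    induction j with
    | zero => exact fun _ => hu
    | succ j ih =>
      intro hj
      have := hT.sub_eq (hmem j hj _ (ih (by omega))) (hi j)
      rw [Function.iterate_succ_apply', Function.iterate_succ_apply']
      linarith [ih (by omega)]
  have huper : T^[m] u = u := Subtype.ext (by rw [hiter m le_rfl, he, hu])
  have hak : T^[k] u = a k :=
    Subtype.ext (by rw [hiter k (Finset.mem_range.1 hk).le, ht]; ring)
  have haper : T^[m] (a k) = a k := by
    rw [← hak, ← Function.iterate_add_apply, add_comm, Function.iterate_add_apply, huper]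
  by_cases hz : a k = ⟨0, le_rfl, one_pos⟩
  · obtain ⟨d, hd, hd0⟩ := hI.exists_apply_eq_zero hT hn
    refine hI.iterate_ne hd hd hm (hT.bijective.1 ?_)
    rw [← Function.iterate_succ_apply' T, Function.iterate_succ_apply, hd0, ← hz, haper]
  · have := mem_divisionPoints_iff.2 ⟨⟨_, hl k⟩, hz⟩
    exact hI.iterate_ne this this hm haper

end IDOC

end IntervalExchange

/-! ### Density of orbits -/

section Density

variable {n : ℕ} {J : Fin n → Set UnitIco} {T : UnitIco → UnitIco}

/-- The points of `[0,1)` that are not accumulated by the forward orbit of `y`. -/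
def rarelyVisited (T : UnitIco → UnitIco) (y : UnitIco) : Set UnitIco :=
  {z | ∃ ε > 0, ∃ N, ∀ k ≥ N, ε ≤ |((T^[k] y : UnitIco) : ℝ) - z|}

lemma exists_nhds_rarelyVisited {y z : UnitIco} (hz : z ∈ rarelyVisited T y) :
    ∃ ε > 0, ∀ w : UnitIco, |(w : ℝ) - z| < ε → w ∈ rarelyVisited T y := by
  obtain ⟨ε, hε, N, h⟩ := hz
  refine ⟨ε / 2, half_pos hε, fun w hw => ⟨ε / 2, half_pos hε, N, fun k hk => ?_⟩⟩
  have := abs_sub_le ((T^[k] y : UnitIco) : ℝ) w z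
  linarith [h k hk]

lemma IsStandardIET.mem_rarelyVisited_iff (hT : IsStandardIET J T) (y : UnitIco) {z : UnitIco}
    (hz : z ∉ leftEndpoints J) : z ∈ rarelyVisited T y ↔ T z ∈ rarelyVisited T y := by
  obtain ⟨ε, hε, h⟩ := hT.exists_local_translation hz
  constructor
  · rintro ⟨ε', hε', N, hN⟩
    refine ⟨min ε ε', lt_min hε hε', N + 1, fun k hk => ?_⟩
    obtain ⟨k, rfl⟩ := Nat.exists_eq_add_of_le' (Nat.le_of_add_left_le hk)
    by_contra! hlt
    rw [Function.iterate_succ_apply'] at hlt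
    have h1 := h _ (Or.inr (hlt.trans_le (min_le_left _ _)))
    rw [h1] at hlt
    exact absurd (hN k (by omega)) (not_le.2 (hlt.trans_le (min_le_right _ _)))
  · rintro ⟨ε', hε', N, hN⟩
    refine ⟨min ε ε', lt_min hε hε', N, fun k hk => ?_⟩
    by_contra! hlt
    have h1 := h _ (Or.inl (hlt.trans_le (min_le_left _ _)))
    rw [← h1, ← Function.iterate_succ_apply' T] at hlt
    exact absurd (hN (k + 1) (by omega)) (not_le.2 (hlt.trans_le (min_le_right _ _)))

namespace IDOC

/-- The left end `e ≠ 0` of a gap would have to reach a left endpoint both in the future and in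
the past, which is a connection between division points. -/
lemma false_of_gap (hI : IDOC J T) (hT : IsStandardIET J T) (hn : 2 ≤ n) {W : Set UnitIco}
    (hW : ∀ z ∉ leftEndpoints J, z ∈ W ↔ T z ∈ W) {e : UnitIco}
    (he0 : e ≠ ⟨0, le_rfl, one_pos⟩) (heW : e ∉ W) {ε : ℝ}
    (hε : 0 < ε) (heε : (e : ℝ) + ε ≤ 1)
    (hgap : ∀ w : UnitIco, e < w → (w : ℝ) < e + ε → w ∈ W) : False := by
  obtain ⟨T, rfl⟩ : ∃ g : UnitIco ≃ UnitIco, ⇑g = T :=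
    ⟨Equiv.ofBijective T hT.bijective, rfl⟩
  have hS := hT.symm
  have hSL := hT.leftEndpoints_symm
  obtain ⟨j, hj⟩ : ∃ j, T^[j] e ∈ leftEndpoints J := by
    by_contra! h
    obtain ⟨k, l, hkl, heq⟩ := hT.exists_iterate_eq_of_gap hW heW hε heε hgap h
    exact hI.iterate_ne_self hT hn e (Nat.sub_pos_of_lt hkl)
      (iterate_sub_eq_of_iterate_eq T.injective hkl heq)
  obtain ⟨k, hk⟩ : ∃ k, T.symm^[k] e ∈ T '' leftEndpoints J := by
    by_contra! h
    obtain ⟨k, l, hkl, heq⟩ := hS.exists_iterate_eq_of_gap (W := W) (by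
      intro z hz
      rw [hSL] at hz
      have := hW (T.symm z) (fun hz' => hz ⟨_, hz', T.apply_symm_apply z⟩)
      rw [T.apply_symm_apply] at this
      exact this.symm) heW hε heε hgap (by simpa only [hSL] using h)
    have hper := iterate_sub_eq_of_iterate_eq T.symm.injective hkl heq
    refine hI.iterate_ne_self hT hn e (Nat.sub_pos_of_lt hkl) ?_
    conv_lhs => rw [← hper]
    exact Function.LeftInverse.iterate T.apply_symm_apply _ e
  obtain ⟨a, ha, hak⟩ := hk
  have hae : T^[k + 1] a = e := by
    rw [Function.iterate_succ_apply, hak]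
    exact Function.LeftInverse.iterate T.apply_symm_apply k e
  by_cases hj0 : T^[j] e = ⟨0, le_rfl, one_pos⟩
  · obtain ⟨d, hd, hd0⟩ := hI.exists_apply_eq_zero hT hn
    cases j with
    | zero => exact he0 hj0
    | succ j =>
      refine hI.iterate_ne_of_mem_leftEndpoints hT hn ha hd (m := j + (k + 1)) (by omega) ?_
      rw [Function.iterate_add_apply, hae]
      refine T.injective ?_
      rw [hd0, ← hj0, Function.iterate_succ_apply']
  · refine hI.iterate_ne_of_mem_leftEndpoints hT hn ha
      (mem_divisionPoints_iff.2 ⟨hj, hj0⟩) (m := j + (k + 1)) (by omega) ?_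
    rw [Function.iterate_add_apply, hae]

/-- A set `W` as in `false_of_gap` which is open, and contains a point other than `0`,
contains all of `(0,1)`. -/
lemma mem_of_ne_zero (hI : IDOC J T) (hT : IsStandardIET J T) (hn : 2 ≤ n) {W : Set UnitIco}
    (hW : ∀ z ∉ leftEndpoints J, z ∈ W ↔ T z ∈ W)
    (hopen : ∀ z ∈ W, ∃ ε > 0, ∀ w : UnitIco, |(w : ℝ) - z| < ε → w ∈ W)
    {z : UnitIco} (hz : z ∈ W) (hz0 : z ≠ ⟨0, le_rfl, one_pos⟩) (b : UnitIco)
    (hb : b ≠ ⟨0, le_rfl, one_pos⟩) : b ∈ W := by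
  have hpos : ∀ w : UnitIco, w ≠ ⟨0, le_rfl, one_pos⟩ → (0 : ℝ) < w := fun w hw =>
    lt_of_le_of_ne w.2.1 fun h => hw (Subtype.ext h.symm)
  have hne : ∀ w : UnitIco, (0 : ℝ) < w → w ≠ ⟨0, le_rfl, one_pos⟩ := fun w hw h => by
    simp [h] at hw
  -- `W` contains everything to the left of each of its points.
  have hdown : ∀ z ∈ W, ∀ w ≤ z, w ≠ ⟨0, le_rfl, one_pos⟩ → w ∈ W := by
    intro z hz w hwz hw0
    by_contra hw
    set C : Set ℝ := {r | ∃ v : UnitIco, v ∉ W ∧ v ≤ z ∧ (v : ℝ) = r}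
    have hbdd : BddAbove C := ⟨z, by rintro _ ⟨v, -, hv, rfl⟩; exact hv⟩
    have hwC : (w : ℝ) ∈ C := ⟨w, hw, hwz, rfl⟩
    have h1 := le_csSup hbdd hwC
    have h2 : sSup C ≤ z := csSup_le ⟨_, hwC⟩ (by rintro _ ⟨v, -, hv, rfl⟩; exact hv)
    obtain ⟨e, he⟩ : ∃ e : UnitIco, (e : ℝ) = sSup C :=
      ⟨⟨sSup C, w.2.1.trans h1, h2.trans_lt z.2.2⟩, rfl⟩
    have heW : e ∉ W := by
      intro heW
      obtain ⟨ε, hε, h⟩ := hopen e heW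
      obtain ⟨_, ⟨v, hv, hvz, rfl⟩, hlt⟩ := exists_lt_of_lt_csSup ⟨_, hwC⟩
        (show sSup C - ε < sSup C by linarith)
      have := le_csSup hbdd ⟨v, hv, hvz, rfl⟩
      exact hv (h v (abs_lt.2 ⟨by linarith, by linarith⟩))
    have hez : (e : ℝ) < z := lt_of_le_of_ne (he ▸ h2) fun h => heW (Subtype.ext h ▸ hz)
    refine hI.false_of_gap hT hn hW (hne e (by linarith [hpos w hw0])) heW (ε := z - e)
      (by linarith) (by linarith [z.2.2]) fun v hv hv' => ?_
    by_contra hvW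
    have := le_csSup hbdd ⟨v, hvW, show (v : ℝ) ≤ z by linarith, rfl⟩
    exact absurd (show (e : ℝ) < v from hv) (by linarith)
  by_contra hbW
  -- The right end of `W` is the point `p`.
  obtain ⟨p, hp0, hpW, hpmin⟩ : ∃ p : UnitIco, p ≠ ⟨0, le_rfl, one_pos⟩ ∧ p ∉ W ∧
      ∀ w : UnitIco, w ≠ ⟨0, le_rfl, one_pos⟩ → (w ∈ W ↔ w < p) := by
    set C : Set ℝ := {r | ∃ v : UnitIco, v ∉ W ∧ v ≠ ⟨0, le_rfl, one_pos⟩ ∧ (v : ℝ) = r}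
    have hbC : (b : ℝ) ∈ C := ⟨b, hbW, hb, rfl⟩
    have hlow : ∀ u ∈ W, ∀ r ∈ C, (u : ℝ) ≤ r := by
      rintro u hu _ ⟨v, hv, hv0, rfl⟩
      by_contra! hlt
      exact hv (hdown u hu v hlt.le hv0)
    have hbdd : BddBelow C := ⟨z, hlow z hz⟩
    have h1 : (z : ℝ) ≤ sInf C := le_csInf ⟨_, hbC⟩ (hlow z hz)
    obtain ⟨p, hp⟩ : ∃ p : UnitIco, (p : ℝ) = sInf C :=
      ⟨⟨sInf C, z.2.1.trans h1, (csInf_le hbdd hbC).trans_lt b.2.2⟩, rfl⟩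
    have hpW : p ∉ W := by
      intro hpW
      obtain ⟨ε, hε, h⟩ := hopen p hpW
      obtain ⟨_, ⟨v, hv, hv0, rfl⟩, hlt⟩ := exists_lt_of_csInf_lt ⟨_, hbC⟩
        (show sInf C < sInf C + ε by linarith)
      have := csInf_le hbdd ⟨v, hv, hv0, rfl⟩
      exact hv (h v (abs_lt.2 ⟨by linarith, by linarith⟩))
    refine ⟨p, hne p (by linarith [hpos z hz0]), hpW, fun w hw0 => ⟨fun hw => ?_, fun hw => ?_⟩⟩
    · refine lt_of_le_of_ne ?_ fun h => hpW (h ▸ hw)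
      exact show (w : ℝ) ≤ p from hp ▸ le_csInf ⟨_, hbC⟩ (hlow w hw)
    · by_contra hwW
      have := csInf_le hbdd ⟨w, hwW, hw0, rfl⟩
      exact absurd (show (w : ℝ) < p from hw) (by linarith)
  -- A point of `(0,1) \ W` that is accumulated by `W` from the left is equal to `p`.
  have huniq : ∀ q : UnitIco, q ≠ ⟨0, le_rfl, one_pos⟩ → q ∉ W → ∀ ε > 0,
      (∀ w : UnitIco, (q : ℝ) - ε < w → w < q → w ∈ W) → q = p := by
    intro q hq0 hq ε hε h
    refine le_antisymm ?_ (not_lt.1 fun hlt => hq ((hpmin q hq0).2 hlt))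
    by_contra! hlt
    have hlt' : (p : ℝ) < q := hlt
    obtain ⟨w, hw⟩ : ∃ w : UnitIco, (w : ℝ) = max (p : ℝ) (q - ε / 2) :=
      ⟨⟨max (p : ℝ) (q - ε / 2), p.2.1.trans (le_max_left _ _), max_lt p.2.2 (by linarith [q.2.2])⟩, rfl⟩
    have h1 := le_max_left (p : ℝ) (q - ε / 2)
    have h2 := le_max_right (p : ℝ) (q - ε / 2)
    have hwW := h w (by linarith) (show (w : ℝ) < q by rw [hw]; exact max_lt hlt' (by linarith))
    have hw0 : (0 : ℝ) < w := by linarith [hpos p hp0]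
    exact absurd (show (w : ℝ) < p from (hpmin w (hne w hw0)).1 hwW) (by linarith)
  have hpgerm : ∃ ε > 0, ∀ w : UnitIco, (p : ℝ) - ε < w → w < p → w ∈ W :=
    ⟨p, hpos p hp0, fun w hw hwp => (hpmin w (hne w (by linarith))).2 hwp⟩
  have hLne : ∀ c ∉ leftEndpoints J, c ≠ ⟨0, le_rfl, one_pos⟩ := fun c hc h =>
    hc (h ▸ hT.zero_mem_leftEndpoints)
  -- If `p` or its preimage were no left endpoint, `p` would be a fixed point; otherwise there is
  -- a connection.
  obtain ⟨c, hc⟩ := hT.bijective.2 p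
  have hcL : c ∈ leftEndpoints J := by
    by_contra hcL
    obtain ⟨ε, hε, h⟩ := (hT.left_germ_iff hW hcL).2 (hc ▸ hpgerm)
    have := huniq c (hLne c hcL) (fun h => hpW (hc ▸ (hW c hcL).1 h)) ε hε h
    rw [this] at hc
    exact hI.iterate_ne_self hT hn p one_pos hc
  have hpL : p ∈ leftEndpoints J := by
    by_contra hpL
    obtain ⟨ε, hε, h⟩ := (hT.left_germ_iff hW hpL).1 hpgerm
    refine hI.iterate_ne_self hT hn p one_pos
      (huniq (T p) (fun h0 => ?_) (fun h => hpW ((hW p hpL).2 h)) ε hε h)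
    obtain ⟨d, hd, hd0⟩ := hI.exists_apply_eq_zero hT hn
    exact hpL (hT.bijective.1 (h0.trans hd0.symm) ▸ hd.2)
  exact hI.iterate_ne_of_mem_leftEndpoints hT hn hcL (mem_divisionPoints_iff.2 ⟨hpL, hp0⟩)
    one_pos hc

/-- Every forward orbit is dense. -/
theorem exists_iterate_mem (hI : IDOC J T) (hT : IsStandardIET J T) (hn : 2 ≤ n) (y : UnitIco)
    {u v : ℝ} (hu : 0 ≤ u) (huv : u < v) (hv : v ≤ 1) :
    ∃ k, u < T^[k] y ∧ ((T^[k] y : UnitIco) : ℝ) < v := by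
  by_contra! hno
  -- If the orbit misses `(u, v)`, the midpoint is not accumulated, hence no point but `0` is.
  have hT0 : T ⟨0, le_rfl, one_pos⟩ ≠ ⟨0, le_rfl, one_pos⟩ :=
    hI.iterate_ne_self hT hn _ one_pos
  obtain ⟨z, hz⟩ : ∃ z : UnitIco, (z : ℝ) = (u + v) / 2 :=
    ⟨⟨(u + v) / 2, by linarith, by linarith⟩, rfl⟩
  have hzW : z ∈ rarelyVisited T y := by
    refine ⟨(v - u) / 2, by linarith, 0, fun k _ => ?_⟩
    by_contra! hlt
    have := abs_lt.1 hlt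
    linarith [hno k (by linarith)]
  have hall := hI.mem_of_ne_zero hT hn (fun z hz => hT.mem_rarelyVisited_iff y hz)
    (fun z hz => exists_nhds_rarelyVisited hz) hzW (fun h => by rw [h] at hz; simp at hz; linarith)
  -- The orbit accumulates at most at `0` and `1`. As `T 0` lies in `(0,1)`, it avoids a
  -- neighbourhood of `0`.
  obtain ⟨η, hη, N, hN⟩ : ∃ η > 0, ∃ N, ∀ k ≥ N, η ≤ ((T^[k] y : UnitIco) : ℝ) := by
    obtain ⟨i, hi⟩ := hT.partition.exists_mem ⟨0, le_rfl, one_pos⟩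
    obtain ⟨a, c, -, -, hl, hJ⟩ := hT.exists_eq i
    obtain ⟨ε, hε, N, h⟩ := hall _ hT0
    refine ⟨min c ε, lt_min ((hJ _).1 hi).2 hε, N, fun k hk => ?_⟩
    by_contra! hlt
    have hki : T^[k] y ∈ J i := (hJ _).2
      ⟨((hJ _).1 hi).1.trans (T^[k] y).2.1, hlt.trans_le (min_le_left _ _)⟩
    have h1 := h (k + 1) (by omega)
    rw [Function.iterate_succ_apply', hT.sub_eq hki hi, sub_zero, abs_of_nonneg (T^[k] y).2.1] at h1
    linarith [min_le_right c ε]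
  -- Hence it tends to `1`, near which `T` is a translation.
  have hlim : ∀ ε > 0, ∃ N, ∀ k ≥ N, 1 - ε < ((T^[k] y : UnitIco) : ℝ) := by
    intro ε hε
    by_contra! hfr
    have hfreq : ∃ᶠ k in Filter.atTop, ((T^[k] y : UnitIco) : ℝ) ∈ Set.Icc η (1 - ε) := by
      rw [Filter.frequently_atTop]
      intro M
      obtain ⟨k, hk, hle⟩ := hfr (max M N)
      exact ⟨k, (le_max_left _ _).trans hk, hN k ((le_max_right _ _).trans hk), hle⟩
    obtain ⟨x, hx, hcl⟩ := isCompact_Icc.exists_mapClusterPt_of_frequently hfreq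
    obtain ⟨ε', hε', M, hM⟩ := hall ⟨x, hη.le.trans hx.1, by linarith [hx.2]⟩ (fun h => by
      have := congrArg Subtype.val h
      simp only at this
      linarith [hx.1])
    obtain ⟨k, hk, hkx⟩ := Filter.frequently_atTop.1
      (mapClusterPt_iff_frequently.1 hcl _ (Metric.ball_mem_nhds x hε')) M
    exact absurd (hM k hk) (not_le.2 hkx)
  obtain ⟨p, hpL, hp⟩ := Set.exists_max_image _ id (finite_leftEndpoints J)
    ⟨_, hT.zero_mem_leftEndpoints⟩
  obtain ⟨i, hpi, hi⟩ := hT.exists_piece_of_forall_notMem (e := p) (ε := 1)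
    fun d hd hlt => absurd (hp d hd) (not_le.2 hlt)
  have hlast : ∀ w : UnitIco, p ≤ w → w ∈ J i := fun w hw =>
    hi w hw (by linarith [w.2.2, p.2.1])
  by_cases ht : T p = p
  · exact hI.iterate_ne_self hT hn p one_pos ht
  · have ht' : (0 : ℝ) < |(T p : ℝ) - p| := abs_pos.2 (sub_ne_zero.2 fun h => ht (Subtype.ext h))
    have hp1 : (0 : ℝ) < 1 - p := by linarith [p.2.2]
    obtain ⟨N, hN⟩ := hlim (min |(T p : ℝ) - p| (1 - p)) (lt_min ht' hp1)
    have h1 := hN N le_rfl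
    have h2 := hN (N + 1) (by omega)
    have h3 := (T^[N] y).2.2
    have h4 := (T^[N + 1] y).2.2
    rw [Function.iterate_succ_apply'] at h2 h4
    have h5 := min_le_left |(T p : ℝ) - p| (1 - p)
    have h6 := min_le_right |(T p : ℝ) - p| (1 - p)
    have h7 := hT.sub_eq (hlast (T^[N] y) (show (p : ℝ) ≤ _ by linarith)) hpi
    have h8 : |(T (T^[N] y) : ℝ) - T^[N] y| < |(T p : ℝ) - p| :=
      abs_lt.2 ⟨by linarith, by linarith⟩
    rw [show (T (T^[N] y) : ℝ) - T^[N] y = T p - p by linarith] at h8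
    exact lt_irrefl _ h8

end IDOC

end Density

/-! ### Codings of interval exchanges -/

section Coding

variable {n : ℕ} {J : Fin n → Set UnitIco} {T : UnitIco → UnitIco}

lemma IsStandardIET.continuousOn (hT : IsStandardIET J T) (i : Fin n) :
    ContinuousOn T (J i) := by
  refine (LipschitzOnWith.of_dist_le_mul (K := 1) fun x hx y hy => ?_).continuousOn
  rw [Subtype.dist_eq, Real.dist_eq, hT.sub_eq hx hy, NNReal.coe_one, one_mul]
  exact le_rfl

/-- Near a point whose first `k` iterates are no left endpoints, the first `k` letters of the
coding do not change. -/
lemma IsStandardIET.exists_nhds_same_pieces (hT : IsStandardIET J T) (z : UnitIco) (k : ℕ)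
    (hz : ∀ j < k, T^[j] z ∉ leftEndpoints J) :
    ∃ ε > 0, ∀ w : UnitIco, |(w : ℝ) - z| < ε →
      ((T^[k] w : UnitIco) : ℝ) - T^[k] z = w - z ∧ ∀ j < k, ∀ i, T^[j] w ∈ J i ↔ T^[j] z ∈ J i := by
  induction k with
  | zero => exact ⟨1, one_pos, fun w _ => ⟨by simp, by simp⟩⟩
  | succ k ih =>
    obtain ⟨ε, hε, h⟩ := ih fun j hj => hz j (by omega)
    obtain ⟨i, δ, hδ, -, -, hi⟩ := hT.exists_nhds_piece (hz k (by omega))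
    refine ⟨min ε δ, lt_min hε hδ, fun w hw => ?_⟩
    obtain ⟨h1, h2⟩ := h w (hw.trans_le (min_le_left _ _))
    have hzi := (hi (T^[k] z) (by simpa using hδ)).1
    have hwi := (hi (T^[k] w) (by rw [h1]; exact hw.trans_le (min_le_right _ _))).1
    refine ⟨?_, fun j hj l => ?_⟩
    · rw [Function.iterate_succ_apply', Function.iterate_succ_apply', hT.sub_eq hwi hzi, h1]
    · rcases Nat.lt_succ_iff_lt_or_eq.1 hj with hj | rfl
      · exact h2 j hj l
      · exact ⟨fun h => hT.partition.eq_of_mem hwi h ▸ hzi,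
          fun h => hT.partition.eq_of_mem hzi h ▸ hwi⟩

/-- All letters but the last one branch, for every length: the right endpoint of `J i` is the image
under `T^k` of an interior point of a cylinder of length `k`, which a dense orbit visits on
both sides. -/
lemma IDOC.mem_branching (hI : IDOC J T) (hT : IsStandardIET J T) (hn : 2 ≤ n) {x : UnitIco}
    {θ : ℕ → Fin n} (hθ : IsCodingOf J T x θ) (k : ℕ) {i t : Fin n}
    (hit : hT.partition.rep i < hT.partition.rep t) : i ∈ branching hT.partition.rep θ k := by
  have hne : i ≠ t := fun h => lt_irrefl _ (h ▸ hit)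
  obtain ⟨a, c, hac, hc, hl, hJ⟩ := hT.exists_eq i
  -- The right endpoint of `J i` is a division point.
  have hc1 : c < 1 := by
    by_contra! hc1
    refine hne (hT.partition.eq_of_mem ((hJ (hT.partition.rep t)).2 ⟨?_, ?_⟩)
      (hT.partition.rep_mem t))
    · exact (hl.2 (hT.partition.rep_mem i)).trans hit.le
    · exact (hT.partition.rep t).2.2.trans_le hc1
  obtain ⟨p, hp⟩ : ∃ p : UnitIco, (p : ℝ) = c := ⟨⟨c, a.2.1.trans hac.le, hc1⟩, rfl⟩
  have hap : (a : ℝ) < p := by linarith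
  have hpd : p ∈ divisionPoints J := mem_divisionPoints_iff.2
    ⟨hT.mem_leftEndpoints_of_right (show a < p from hap) (hp ▸ hJ), fun h => by
      rw [h] at hap; exact absurd a.2.1 (not_le.2 hap)⟩
  obtain ⟨z, hz⟩ := (hT.bijective.iterate k).2 p
  have hzL : ∀ j < k, T^[j] z ∉ leftEndpoints J := by
    intro j hj hL
    refine hI.iterate_ne_of_mem_leftEndpoints hT hn hL hpd (m := k - j) (by omega) ?_
    rw [← Function.iterate_add_apply, Nat.sub_add_cancel hj.le, hz]
  obtain ⟨ε, hε, h⟩ := hT.exists_nhds_same_pieces z k hzL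
  have hz0 : (0 : ℝ) < z := by
    refine lt_of_le_of_ne z.2.1 fun h0 => ?_
    have h0' : z = ⟨0, le_rfl, one_pos⟩ := Subtype.ext h0.symm
    cases k with
    | zero => exact absurd (hz ▸ h0' : p = _) (mem_divisionPoints_iff.1 hpd).2
    | succ k => exact hzL 0 (by omega) (by rw [h0']; exact hT.zero_mem_leftEndpoints)
  obtain ⟨m, hm1, hm2⟩ := hI.exists_iterate_mem hT hn x
    (u := max 0 (z - min ε (p - a))) (v := z) (le_max_left _ _)
    (max_lt hz0 (by linarith [lt_min hε (sub_pos.2 hap)])) z.2.2.le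
  obtain ⟨m', hm1', hm2'⟩ := hI.exists_iterate_mem hT hn x
    (u := z) (v := min 1 (z + ε)) z.2.1 (lt_min z.2.2 (by linarith)) (min_le_left _ _)
  have hm3 := (le_max_right _ _).trans_lt hm1
  have hm4 := hm2'.trans_le (min_le_right _ _)
  have h1 := min_le_left ε ((p : ℝ) - a)
  have h2 := min_le_right ε ((p : ℝ) - a)
  obtain ⟨hs, hw⟩ := h (T^[m] x) (abs_lt.2 ⟨by linarith, by linarith⟩)
  obtain ⟨hs', hw'⟩ := h (T^[m'] x) (abs_lt.2 ⟨by linarith, by linarith⟩)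
  have hit : ∀ m j, T^[j] (T^[m] x) = T^[m + j] x := fun m j => by
    rw [← Function.iterate_add_apply, add_comm]
  rw [hit, hz] at hs hs'
  have hmi : T^[m + k] x ∈ J i := (hJ _).2 ⟨show (a : ℝ) ≤ _ by linarith, by linarith⟩
  have hθi : θ (m + k) = i := hT.partition.eq_of_mem (hθ _) hmi
  refine ⟨m, m', fun j hj => ?_, hθi, ?_⟩
  · refine hT.partition.eq_of_mem (x := T^[m' + j] x) ?_ (hθ _)
    rw [← hit, hw' j hj, ← hw j hj, hit]
    exact hθ _
  · refine (hT.partition.rep_lt_iff (fun he => ?_) hmi (hθ (m' + k))).2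
      (show ((T^[m + k] x : UnitIco) : ℝ) < T^[m' + k] x by linarith)
    have := ((hJ _).1 (he ▸ hθ (m' + k))).2
    linarith

lemma IDOC.complexity_eq (hI : IDOC J T) (hT : IsStandardIET J T) (hn : 2 ≤ n) {x : UnitIco}
    {θ : ℕ → Fin n} (hθ : IsCodingOf J T x θ) (k : ℕ) :
    complexity θ k = (n - 1) * k + 1 := by
  induction k with
  | zero => simp [complexity_zero]
  | succ k ih =>
    rw [hθ.complexity_succ hT.partition hT.continuousOn hT.bijective.1, ih]
    have hle := hT.partition.ncard_branching_le θ k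
    obtain ⟨t, ht⟩ := hT.partition.exists_top
    have hge : ({t}ᶜ : Set (Fin n)).ncard ≤ (branching hT.partition.rep θ k).ncard :=
      Set.ncard_le_ncard (fun i hi => hI.mem_branching hT hn hθ k ((ht i).2 hi)) (Set.toFinite _)
    rw [Set.ncard_compl, Set.ncard_singleton, Nat.card_fin] at hge
    rw [le_antisymm hle hge]
    ring

end Coding

/-! ### The associated contraction -/

section Contraction

variable {n : ℕ} {J : Fin n → Set UnitIco} {T : UnitIco → UnitIco}

/-- The mass of `A` for the probability measure with an atom of mass `2^-(k+1)` at `T^(k+1) d`,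
for `k = 0, 1, …`. -/
noncomputable def orbitMass (T : UnitIco → UnitIco) (d : UnitIco) (A : Set ℝ) : ℝ :=
  ∑' k : ℕ, A.indicator (fun _ => (1 / 2 : ℝ) ^ (k + 1)) (T^[k + 1] d : ℝ)

lemma orbitMass_term_nonneg (d : UnitIco) (A : Set ℝ) (k : ℕ) :
    0 ≤ A.indicator (fun _ => (1 / 2 : ℝ) ^ (k + 1)) (T^[k + 1] d : ℝ) :=
  Set.indicator_nonneg (fun _ _ => by positivity) _

lemma orbitMass_term_le (d : UnitIco) (A : Set ℝ) (k : ℕ) :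
    A.indicator (fun _ => (1 / 2 : ℝ) ^ (k + 1)) (T^[k + 1] d : ℝ) ≤ (1 / 2 : ℝ) ^ (k + 1) :=
  Set.indicator_le_self' (fun _ _ => by positivity) _

lemma summable_half_pow : Summable fun k : ℕ => (1 / 2 : ℝ) ^ (k + 1) :=
  (summable_nat_add_iff 1).2 summable_geometric_two

lemma summable_orbitMass (d : UnitIco) (A : Set ℝ) :
    Summable fun k : ℕ => A.indicator (fun _ => (1 / 2 : ℝ) ^ (k + 1)) (T^[k + 1] d : ℝ) :=
  Summable.of_nonneg_of_le (orbitMass_term_nonneg d A) (orbitMass_term_le d A) summable_half_pow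

lemma orbitMass_nonneg (d : UnitIco) (A : Set ℝ) : 0 ≤ orbitMass T d A :=
  tsum_nonneg (orbitMass_term_nonneg d A)

lemma orbitMass_eq_one {d : UnitIco} {A : Set ℝ} (hA : Set.Ico 0 1 ⊆ A) :
    orbitMass T d A = 1 := by
  have : ∀ k : ℕ, A.indicator (fun _ => (1 / 2 : ℝ) ^ (k + 1)) (T^[k + 1] d : ℝ)
      = (1 / 2 : ℝ) ^ (k + 1) := fun k => Set.indicator_of_mem (hA (T^[k + 1] d).2) _
  rw [orbitMass, tsum_congr this]
  have h := summable_geometric_two.tsum_eq_zero_add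
  rw [tsum_geometric_two] at h
  norm_num at h ⊢
  linarith

lemma orbitMass_union (d : UnitIco) {A B : Set ℝ} (hAB : Disjoint A B) :
    orbitMass T d (A ∪ B) = orbitMass T d A + orbitMass T d B := by
  rw [orbitMass, orbitMass, orbitMass,
    ← (summable_orbitMass d A).tsum_add (summable_orbitMass d B)]
  exact tsum_congr fun k => by rw [Set.indicator_union_of_disjoint hAB]

lemma orbitMass_pos {d : UnitIco} {A : Set ℝ} {k : ℕ} (h : (T^[k + 1] d : ℝ) ∈ A) :
    0 < orbitMass T d A :=
  (summable_orbitMass d A).tsum_pos (orbitMass_term_nonneg d A) k (by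
    rw [Set.indicator_of_mem h]; positivity)

/-- Transport by `T` halves the mass, apart from the new atom at `T d`. -/
lemma orbitMass_preimage (d : UnitIco) {A B : Set ℝ}
    (h : ∀ u : UnitIco, (T u : ℝ) ∈ B ↔ (u : ℝ) ∈ A) :
    orbitMass T d B = A.indicator (fun _ => 1 / 2) (d : ℝ) + 1 / 2 * orbitMass T d A := by
  have hterm : ∀ k : ℕ, B.indicator (fun _ => (1 / 2 : ℝ) ^ (k + 1)) (T^[k + 1] d : ℝ)
      = A.indicator (fun _ => (1 / 2 : ℝ) ^ (k + 1)) (T^[k] d : ℝ) := by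
    intro k
    rw [Function.iterate_succ_apply']
    by_cases hk : ((T^[k] d : UnitIco) : ℝ) ∈ A
    · rw [Set.indicator_of_mem hk, Set.indicator_of_mem ((h _).2 hk)]
    · rw [Set.indicator_of_notMem hk, Set.indicator_of_notMem fun h' => hk ((h _).1 h')]
  have hs := summable_orbitMass (T := T) d B
  rw [orbitMass, hs.tsum_eq_zero_add, hterm 0, orbitMass, ← tsum_mul_left]
  congr 1
  · simp
  · refine tsum_congr fun k => ?_
    rw [hterm, ← Set.indicator_const_mul]
    congr 1
    funext _
    ring

lemma tendsto_orbitMass {d : UnitIco} {F : Filter ℝ} {A : ℝ → Set ℝ} {B : Set ℝ}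
    (h : ∀ r : ℝ, ∀ᶠ y in F, (r ∈ A y ↔ r ∈ B)) :
    Filter.Tendsto (fun y => orbitMass T d (A y)) F (nhds (orbitMass T d B)) := by
  refine tendsto_tsum_of_dominated_convergence summable_half_pow (fun k => ?_) ?_
  · refine tendsto_const_nhds.congr' ?_
    filter_upwards [h (T^[k + 1] d)] with y hy
    by_cases hk : ((T^[k + 1] d : UnitIco) : ℝ) ∈ B
    · rw [Set.indicator_of_mem hk, Set.indicator_of_mem (hy.2 hk)]
    · rw [Set.indicator_of_notMem hk, Set.indicator_of_notMem fun h' => hk (hy.1 h')]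
  · refine Filter.Eventually.of_forall fun y k => ?_
    rw [Real.norm_of_nonneg (orbitMass_term_nonneg d _ k)]
    exact orbitMass_term_le d _ k

lemma orbitMass_mono (d : UnitIco) {A B : Set ℝ} (h : A ⊆ B) :
    orbitMass T d A ≤ orbitMass T d B := by
  rw [← Set.union_sdiff_cancel h, orbitMass_union d Set.disjoint_sdiff_right]
  linarith [orbitMass_nonneg (T := T) d (B \ A)]

lemma orbitMass_Iic_eq (d : UnitIco) (y : ℝ) :
    orbitMass T d (Set.Iic y) = orbitMass T d (Set.Iio y) + orbitMass T d {y} := by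
  rw [← orbitMass_union d (by simp), Set.Iio_union_right]

lemma orbitMass_Iic_sub (d : UnitIco) {y y' : ℝ} (h : y ≤ y') :
    orbitMass T d (Set.Iic y') - orbitMass T d (Set.Iic y) = orbitMass T d (Set.Ioc y y') := by
  rw [← Set.Iic_union_Ioc_eq_Iic h,
    orbitMass_union d ((Set.Iic_disjoint_Ioi le_rfl).mono_right Set.Ioc_subset_Ioi_self)]
  ring

/-- The distribution function of the orbit mass has a generalized inverse. -/
lemma exists_orbitMass_le (d x : UnitIco) : ∃ y : UnitIco,
    orbitMass T d (Set.Iio (y : ℝ)) ≤ x ∧ (x : ℝ) ≤ orbitMass T d (Set.Iic (y : ℝ)) := by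
  set C : Set ℝ := {y | orbitMass T d (Set.Iio y) ≤ x}
  have h0 : (0 : ℝ) ∈ C := by
    have hk : ∀ k : ℕ, (Set.Iio (0 : ℝ)).indicator (fun _ => (1 / 2 : ℝ) ^ (k + 1))
        (T^[k + 1] d : ℝ) = 0 := fun k =>
      Set.indicator_of_notMem (fun hr : _ ∈ Set.Iio (0 : ℝ) =>
        absurd hr (not_lt.2 (T^[k + 1] d).2.1)) _
    have : orbitMass T d (Set.Iio 0) = 0 := (tsum_congr hk).trans tsum_zero
    exact this.trans_le x.2.1
  have hC1 : ∀ y ∈ C, y < 1 := by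
    intro y hy
    by_contra! h1
    have : orbitMass T d (Set.Iio y) = 1 := orbitMass_eq_one fun r hr => hr.2.trans_le h1
    exact absurd x.2.2 (not_lt.2 (this.symm.trans_le hy))
  have hbdd : BddAbove C := ⟨1, fun y hy => (hC1 y hy).le⟩
  have hs : sSup C ∈ C := by
    have hdown : ∀ y < sSup C, y ∈ C := by
      intro y hy
      obtain ⟨y', hy', hlt⟩ := exists_lt_of_lt_csSup ⟨0, h0⟩ hy
      exact (orbitMass_mono d (Set.Iio_subset_Iio hlt.le)).trans hy'
    refine le_of_tendsto (tendsto_orbitMass (F := nhdsWithin (sSup C) (Set.Iio (sSup C)))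
      (A := Set.Iio) (B := Set.Iio (sSup C)) fun r => ?_) ?_
    · rcases lt_or_ge r (sSup C) with hr | hr
      · filter_upwards [Ioo_mem_nhdsLT hr] with y hy
        exact iff_of_true hy.1 hr
      · filter_upwards [self_mem_nhdsWithin] with y hy
        exact iff_of_false (not_lt.2 (le_of_lt (lt_of_lt_of_le hy hr))) (not_lt.2 hr)
    · filter_upwards [self_mem_nhdsWithin] with y hy
      exact hdown y hy
  have hs0 : 0 ≤ sSup C := le_csSup hbdd h0
  refine ⟨⟨sSup C, hs0, hC1 _ hs⟩, hs, ?_⟩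
  refine ge_of_tendsto (tendsto_orbitMass (F := nhdsWithin (sSup C) (Set.Ioi (sSup C)))
      (A := Set.Iio) (B := Set.Iic (sSup C)) fun r => ?_) ?_
  · rcases le_or_gt r (sSup C) with hr | hr
    · filter_upwards [self_mem_nhdsWithin] with y hy
      exact iff_of_true (lt_of_le_of_lt hr hy) hr
    · filter_upwards [Ioo_mem_nhdsGT hr] with y hy
      exact iff_of_false (not_lt.2 hy.2.le) (not_le.2 hr)
  · filter_upwards [self_mem_nhdsWithin] with y hy
    by_contra! hlt
    exact absurd (le_csSup hbdd hlt.le) (not_le.2 hy)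

/-- The semiconjugacy is the generalized inverse `h` of the distribution function of `orbitMass`,
which opens a gap at each point of the forward orbit of `T d`. The contraction sends the right end
of the gap over `y` to the right end of the gap over `T y`, with slope `1/2`. As the atom at `T d`
arises at the left end of a piece, aligning gaps by their right ends makes the map affine on
the preimage of that piece. -/
theorem IDOC.exists_isAssociatedContraction (hI : IDOC J T) (hT : IsStandardIET J T)
    (hn : 2 ≤ n) : ∃ (K : Fin n → Set UnitIco) (f : UnitIco → UnitIco),
      IsAssociatedContraction J T K f := by
  obtain ⟨d, hd, -⟩ := hI.exists_apply_eq_zero hT hn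
  set G : ℝ → ℝ := fun y => orbitMass T d (Set.Iio y) with hG
  set G' : ℝ → ℝ := fun y => orbitMass T d (Set.Iic y) with hG'
  have hdense : ∀ u v : ℝ, 0 ≤ u → u < v → v ≤ 1 → ∃ k, u < T^[k + 1] d ∧
      ((T^[k + 1] d : UnitIco) : ℝ) < v := fun u v h0 h1 h2 => by
    simpa only [Function.iterate_succ_apply] using hI.exists_iterate_mem hT hn (T d) h0 h1 h2
  have hlt : ∀ y y' : UnitIco, y < y' → G' y < G y' := by
    intro y y' h
    have h' : (y : ℝ) < y' := h
    obtain ⟨k, hk1, hk2⟩ := hdense y y' y.2.1 h' y'.2.2.le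
    have := orbitMass_pos (T := T) (d := d) (A := Set.Ioo (y : ℝ) y') ⟨hk1, hk2⟩
    have h2 : G y' = G' y + orbitMass T d (Set.Ioo (y : ℝ) y') := by
      simp only [hG, hG']
      rw [← Set.Iic_union_Ioo_eq_Iio h',
        orbitMass_union d ((Set.Iic_disjoint_Ioi le_rfl).mono_right Set.Ioo_subset_Ioi_self)]
    linarith
  have hG1 : ∀ y : UnitIco, G' y < 1 := by
    intro y
    obtain ⟨k, hk1, hk2⟩ := hdense y 1 y.2.1 y.2.2 le_rfl
    have := orbitMass_pos (T := T) (d := d) (A := Set.Ioi (y : ℝ)) hk1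
    have h2 : orbitMass T d (Set.Iic (y : ℝ) ∪ Set.Ioi y) = 1 :=
      orbitMass_eq_one fun r _ => le_or_gt r (y : ℝ)
    rw [orbitMass_union d (Set.Iic_disjoint_Ioi le_rfl)] at h2
    simp only [hG']
    linarith
  have hGG' : ∀ y : ℝ, G' y = G y + orbitMass T d {y} := fun y => orbitMass_Iic_eq d y
  have hatom : ∀ y : ℝ, 0 ≤ orbitMass T d {y} := fun y => orbitMass_nonneg d _
  have hG0 : ∀ y, 0 ≤ G y := fun y => orbitMass_nonneg d _
  choose h hh1 hh2 using exists_orbitMass_le (T := T) d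
  have huniq : ∀ x y : UnitIco, G y ≤ x → x ≤ G' y → h x = y := by
    intro x y h1 h2
    rcases lt_trichotomy (h x) y with hxy | hxy | hxy
    · exact absurd ((hlt _ _ hxy).trans_le (h1.trans (hh2 x))) (lt_irrefl _)
    · exact hxy
    · exact absurd ((hlt _ _ hxy).trans_le ((hh1 x).trans h2)) (lt_irrefl _)
  have hmono : Monotone h := by
    intro x x' hxx
    by_contra! hlt'
    exact absurd ((hlt _ _ hlt').trans_le ((hh1 x).trans
      ((show (x : ℝ) ≤ x' from hxx).trans (hh2 x')))) (lt_irrefl _)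
  have hsurj : Function.Surjective h := by
    intro y
    have hle : G y ≤ G' y := by linarith [hGG' y, hatom y]
    exact ⟨⟨G y, hG0 y, hle.trans_lt (hG1 y)⟩, huniq _ y le_rfl hle⟩
  have hTatom : ∀ y : UnitIco, 1 / 2 * orbitMass T d {(y : ℝ)} ≤ orbitMass T d {(T y : ℝ)} := by
    intro y
    rw [orbitMass_preimage d (A := {(y : ℝ)}) (B := {(T y : ℝ)}) fun u => by
      simp only [Set.mem_singleton_iff, Subtype.coe_inj, hT.bijective.1.eq_iff]]
    have : 0 ≤ Set.indicator {(y : ℝ)} (fun _ => (1 / 2 : ℝ)) (d : ℝ) :=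
      Set.indicator_nonneg (fun _ _ => by norm_num) _
    linarith
  have hlow : ∀ x : UnitIco, G (T (h x)) ≤ G' (T (h x)) - 1 / 2 * (G' (h x) - x) := by
    intro x
    have h1 : G (h x) ≤ x := hh1 x
    linarith [hGG' (h x), hGG' (T (h x)), hTatom (h x), hatom (h x)]
  have hupp : ∀ x : UnitIco, G' (T (h x)) - 1 / 2 * (G' (h x) - x) ≤ G' (T (h x)) := by
    intro x
    have h1 : (x : ℝ) ≤ G' (h x) := hh2 x
    linarith
  obtain ⟨f, hf⟩ : ∃ f : UnitIco → UnitIco,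
      ∀ x, (f x : ℝ) = G' (T (h x)) - 1 / 2 * (G' (h x) - x) :=
    ⟨fun x => ⟨G' (T (h x)) - 1 / 2 * (G' (h x) - x), (hG0 _).trans (hlow x),
      (hupp x).trans_lt (hG1 _)⟩, fun x => rfl⟩
  have hconj : ∀ x, h (f x) = T (h x) := fun x =>
    huniq _ _ (by rw [hf]; exact hlow x) (by rw [hf]; exact hupp x)
  have hinj : Function.Injective f := by
    intro x x' hxx
    have h1 : h x = h x' := hT.bijective.1 (by rw [← hconj, ← hconj, hxx])
    have h2 := congrArg Subtype.val hxx
    rw [hf, hf, h1] at h2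
    exact Subtype.ext (by linarith)
  have hiter : ∀ k x, h (f^[k] x) = T^[k] (h x) := fun k x =>
    (Function.Semiconj.iterate_right hconj k) x
  -- On a piece of the exchange, the right ends of gaps are contracted by the factor `1/2`.
  have hpiece : ∀ i, ∀ y ∈ J i, ∀ y' ∈ J i, y ≤ y' →
      G' (T y') - 1 / 2 * G' y' = G' (T y) - 1 / 2 * G' y := by
    intro i y hy y' hy' hle
    have hle' : (y : ℝ) ≤ y' := hle
    have hs := hT.sub_eq hy' hy
    have key := orbitMass_preimage (T := T) d (A := Set.Ioc (y : ℝ) y')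
      (B := Set.Ioc (T y : ℝ) (T y')) fun u => by
        constructor
        · rintro ⟨h1, h2⟩
          obtain ⟨v, hv⟩ : ∃ v : UnitIco, (v : ℝ) = y + (T u - T y) :=
            ⟨⟨y + (T u - T y), by linarith [y.2.1], by linarith [y'.2.2]⟩, rfl⟩
          have hvi : v ∈ J i := (hT.partition.ordConnected i).out hy hy'
            ⟨show (y : ℝ) ≤ v by linarith, show (v : ℝ) ≤ y' by linarith⟩
          have huv : v = u := hT.bijective.1 (Subtype.ext (by linarith [hT.sub_eq hvi hy]))
          rw [← huv]
          exact ⟨by linarith, by linarith⟩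
        · rintro ⟨h1, h2⟩
          have hui : u ∈ J i := (hT.partition.ordConnected i).out hy hy' ⟨h1.le, h2⟩
          have := hT.sub_eq hui hy
          exact ⟨by linarith, by linarith⟩
    have hdn : (d : ℝ) ∉ Set.Ioc (y : ℝ) y' := by
      rintro ⟨h1, h2⟩
      obtain ⟨j, hj⟩ := hd.2
      obtain rfl := hT.partition.eq_of_mem hj.1
        ((hT.partition.ordConnected i).out hy hy' ⟨h1.le, h2⟩)
      exact absurd (hj.2 hy) (not_le.2 h1)
    rw [Set.indicator_of_notMem hdn, ← orbitMass_Iic_sub d hle',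
      ← orbitMass_Iic_sub d (by linarith)] at key
    simp only [hG']
    linarith
  have hpiece' : ∀ i, ∀ y ∈ J i, ∀ y' ∈ J i,
      G' (T y') - 1 / 2 * G' y' = G' (T y) - 1 / 2 * G' y := by
    intro i y hy y' hy'
    rcases le_total y y' with h | h
    · exact hpiece i y hy y' hy' h
    · exact (hpiece i y' hy' y hy h).symm
  have hJ := hT.partition
  refine ⟨fun i => h ⁻¹' J i, f, hinj, ⟨⟨fun i => ?_, fun i => ?_, fun i j hij => ?_, ?_⟩,
    by norm_num, by norm_num, ?_⟩, h, hmono.continuous_of_surjective hsurj, hsurj, hmono, ?_⟩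
  · exact (hJ.ordConnected i).preimage_mono hmono
  · exact (hJ.nontrivial i).preimage hsurj
  · exact (hJ.disjoint i j hij).preimage h
  · rw [← Set.preimage_iUnion, hJ.cover, Set.preimage_univ]
  · refine ⟨fun _ => 1, fun i => G' (T (hJ.rep i)) - 1 / 2 * G' (hJ.rep i), fun _ => Or.inl rfl,
      fun i x hx => ?_⟩
    simp only [hf, ← hpiece' i _ (hJ.rep_mem i) _ hx]
    ring
  · intro x θ
    simp only [IsCodingOf, Set.mem_preimage, hiter]

end Contraction

end IntervalDynamics

theorem corollary2 (n : ℕ) :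
    (∀ (J : Fin n → Set UnitIco) (f : UnitIco → UnitIco),
      IsPC J f → Function.Injective f →
      ∀ θ : ℕ → Fin n, IsNaturalCoding J f θ →
        ∃ α β k₀ : ℕ, α < n ∧ 1 ≤ β ∧ 1 ≤ k₀ ∧
          (∀ k, k₀ ≤ k → complexity θ k = α * k + β) ∧ (α = n - 1 → β = 1)) ∧
    (2 ≤ n →
      ∀ (J : Fin n → Set UnitIco) (T : UnitIco → UnitIco), IsStandardIET J T → IDOC J T →
        (∃ (K : Fin n → Set UnitIco) (f : UnitIco → UnitIco), IsAssociatedContraction J T K f) ∧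
        ∀ (K : Fin n → Set UnitIco) (f : UnitIco → UnitIco), IsAssociatedContraction J T K f →
          ∀ θ : ℕ → Fin n, IsNaturalCoding K f θ →
            ∀ k, 1 ≤ k → complexity θ k = (n - 1) * k + 1) := by
  refine ⟨fun J f hf hinj θ hθ => hf.complexity_eventually_affine hinj hθ,
    fun hn J T hT hI => ⟨hI.exists_isAssociatedContraction hT hn, fun K f hK θ hθ k _ => ?_⟩⟩
  obtain ⟨x, hx⟩ := hθ
  obtain ⟨h, -, -, -, hcod⟩ := hK.factor
  exact hI.complexity_eq hT hn ((hcod x θ).1 hx) k
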